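/- Let $\Gamma$ be a free abelian group of finite rank $k\le 2$, and let $G$ be a finite $\Gamma$-labeled graph without isolated vertices: a finite directed multigraph with vertex set $V$ and edge set $E$ and a label $\psi(e)\in\Gamma$ on every edge, where reversing an edge inverts its label. $G$ is assumed loopless and semi-simple, i.e. no two distinct edges are parallel with the same label (up to simultaneously reversing the direction and inverting the label). The label of a closed walk is the signed sum of the labels of its edges. The rank of a subgraph $H$ is the rank of the subgroup of $\Gamma$ generated by the labels of the closed walks in $H$. An edge set is balanced if every closed walk in it has trivial label, and $G$ is unbalanced if $E$ is not balanced. A $(0,2)$-block of $G$ is a subgraph $H$ of rank $0$ such that the set $B(H)$ of vertices of $H$ incident to an edge of $E\setminus E(H)$ has exactly two elements and $V(H)\setminus B(H)\neq\emptyset$. $G$ is 2-connected if it has at least two vertices, is connected and has no cut vertex. For a homomorphism $L:\Gamma\to\mathbb{R}^2$ and $p:V\to\mathbb{R}^2$, $(G,\psi,p)$ is $L$-periodically rigid if for all $q$ in some neighborhood of $p$ in $(\mathbb{R}^2)^V$ the following holds: if $\|p(u)-(p(v)+L(\psi(e)))\|=\|q(u)-(q(v)+L(\psi(e)))\|$ for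 every edge $e$ from $u$ to $v$, then $\|p(u)-(p(v)+L(\gamma))\|=\|q(u)-(q(v)+L(\gamma))\|$ for all $u,v\in V$ and $\gamma\in\Gamma$. The homomorphism $L$ is nonsingular if $L(\Gamma)$ spans a space of dimension $k$, and $p$ is generic (for $L$) if its $2|V|$ coordinates are algebraically independent over the field generated over $\mathbb{Q}$ by the coordinates of the values of $L$. $G$ is periodically rigid if $(G,\psi,p)$ is $L$-periodically rigid for some generic $p$ and some nonsingular $L$ [respectively: for any generic $p$ and any nonsingular $L$], and redundantly periodically rigid if $G-e$ is periodically rigid for every $e\in E$. For $F\subseteq E$ let $V(F)$ be the set of vertices incident to $F$. Call $I\subseteq E$ independent if $|F|\le 2|V(F)|-2$ for every nonempty $F\subseteq I$ and $|F|\le 2|V(F)|-3$ for every nonempty balanced $F\subseteq I$. These are the independent sets of a matroid on $E$, the restriction to $E$ of the periodic count matroid $\mathcal{R}_2(V,\Gamma)$. $G$ is M-connected if this matroid has at least two elements and any two distinct elements lie in a common circuit. Theorem. Suppose that $G$ is unbalanced and has no $(0,2)$-block. Then $G$ is 2-connected and redundantly periodically rigid if and only if $G$ is M-connected. This holds with either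 of the two forms (some / any) of periodic rigidity. -/

import Mathlib

open Filter Topology

/-- A `Γ`-labeled graph on the vertex set `V` with edge set `E`: a directed multigraph with a label
in `Γ` on every edge. `Γ` is written additively. It is loopless, and semi-simple: no two distinct
edges are identical, where a label `γ` in one direction is the label `-γ` in the other. -/
structure LabeledGraph (V E Γ : Type*) [AddCommGroup Γ] where
  src : E → V
  tgt : E → V
  label : E → Γ
  loopless : ∀ e, src e ≠ tgt e
  semisimple : ∀ e f, e ≠ f →
    ¬ (src e = src f ∧ tgt e = tgt f ∧ label e = label f) ∧
    ¬ (src e = tgt f ∧ tgt e = src f ∧ label e = -label f)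

namespace LabeledGraph

variable {V E Γ : Type*} [AddCommGroup Γ]

/-- `G.HasWalk F u w g`: there is a walk from `u` to `w` using only edges of `F`, traversed in
either direction, whose total signed label is `g`. -/
inductive HasWalk (G : LabeledGraph V E Γ) (F : Set E) : V → V → Γ → Prop
  | nil (v : V) : HasWalk G F v v 0
  | forward {e : E} (he : e ∈ F) {w : V} {g : Γ} (h : HasWalk G F (G.tgt e) w g) :
      HasWalk G F (G.src e) w (G.label e + g)
  | backward {e : E} (he : e ∈ F) {w : V} {g : Γ} (h : HasWalk G F (G.src e) w g) :
      HasWalk G F (G.tgt e) w (-G.label e + g)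

/-- The subgroup of `Γ` generated by the labels of all closed walks in `F`. -/
def gainGroup (G : LabeledGraph V E Γ) (F : Set E) : AddSubgroup Γ :=
  AddSubgroup.closure {g | ∃ v, G.HasWalk F v v g}

/-- The rank of an edge set (or of a subgraph with this edge set). -/
noncomputable def rank (G : LabeledGraph V E Γ) (F : Set E) : ℕ :=
  Module.finrank ℤ (G.gainGroup F)

/-- An edge set is balanced if every closed walk in it has trivial label. -/
def Balanced (G : LabeledGraph V E Γ) (F : Set E) : Prop :=
  ∀ v g, G.HasWalk F v v g → g = 0

/-- `V(F)`, the set of vertices incident to `F`. -/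
def vertexSet (G : LabeledGraph V E Γ) (F : Set E) : Set V :=
  {v | ∃ e ∈ F, G.src e = v ∨ G.tgt e = v}

/-- The underlying simple graph; it has the same connectivity properties. -/
def toSimpleGraph (G : LabeledGraph V E Γ) : SimpleGraph V where
  Adj u v := ∃ e, (G.src e = u ∧ G.tgt e = v) ∨ (G.src e = v ∧ G.tgt e = u)
  symm := ⟨fun _ _ ⟨e, h⟩ => ⟨e, h.symm⟩⟩
  loopless := ⟨fun _ ⟨e, h⟩ => G.loopless e (by rcases h with ⟨a, b⟩ | ⟨a, b⟩ <;> exact a.trans b.symm)⟩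

/-- 2-connected: at least two vertices, connected, and no cut vertex. (Two vertices joined by
parallel edges form a 2-connected multigraph.) -/
def TwoConnected (G : LabeledGraph V E Γ) : Prop :=
  Nontrivial V ∧ G.toSimpleGraph.Connected ∧
    ∀ v, (G.toSimpleGraph.induce {v}ᶜ).Connected

/-- The `Γ`-labeled graph `G - e`. -/
def deleteEdge (G : LabeledGraph V E Γ) (e : E) : LabeledGraph V {f : E // f ≠ e} Γ where
  src f := G.src f
  tgt f := G.tgt f
  label f := G.label f
  loopless f := G.loopless f
  semisimple f f' h := G.semisimple f f' (fun h' => h (Subtype.ext h'))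

/-! ### Blocks -/

/-- A subgraph of `G`. -/
structure Subgraph (G : LabeledGraph V E Γ) where
  verts : Set V
  edges : Set E
  src_mem : ∀ e ∈ edges, G.src e ∈ verts
  tgt_mem : ∀ e ∈ edges, G.tgt e ∈ verts

/-- `B(H)`: the vertices of `H` incident to some edge of `G` outside `H`. -/
def Subgraph.boundary {G : LabeledGraph V E Γ} (H : G.Subgraph) : Set V :=
  H.verts ∩ G.vertexSet H.edgesᶜ

/-- `I(H) = V(H) \ B(H)`. -/
def Subgraph.inner {G : LabeledGraph V E Γ} (H : G.Subgraph) : Set V :=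
  H.verts \ H.boundary

/-- `H` is an `(s,t)`-block. -/
def Subgraph.IsBlock {G : LabeledGraph V E Γ} (H : G.Subgraph) (s t : ℕ) : Prop :=
  G.rank H.edges = s ∧ H.boundary.ncard = t ∧ H.inner.Nonempty

/-! ### Periodic rigidity -/

/-- A homomorphism `L : Γ → ℝ^d` is nonsingular if its image has the rank of `Γ`. -/
def Nonsingular {d : ℕ} (L : Γ →+ EuclideanSpace ℝ (Fin d)) : Prop :=
  Module.finrank ℝ (Submodule.span ℝ (Set.range L)) = Module.finrank ℤ Γ

/-- The coordinates of `p` are algebraically independent over the field generated by the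
coordinates of the values of `L` (this field is `ℚ` if `L` is rational-valued). -/
def Generic {d : ℕ} (L : Γ →+ EuclideanSpace ℝ (Fin d)) (p : V → EuclideanSpace ℝ (Fin d)) :
    Prop :=
  AlgebraicIndependent (IntermediateField.adjoin ℚ {x : ℝ | ∃ γ i, x = L γ i})
    (fun vi : V × Fin d => p vi.1 vi.2)

/-- The framework `(G, ψ, p)` is `L`-periodically rigid: for all `q` near `p`, if the lengths of all
edges of `G` agree in `p` and `q` then so do the lengths of all edges of the complete `Γ`-labeled
graph on `V`. -/
def LPeriodicallyRigid {d : ℕ} (G : LabeledGraph V E Γ) (L : Γ →+ EuclideanSpace ℝ (Fin d))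
    (p : V → EuclideanSpace ℝ (Fin d)) : Prop :=
  ∀ᶠ q in 𝓝 p,
    (∀ e, ‖p (G.src e) - (p (G.tgt e) + L (G.label e))‖ ^ 2 =
      ‖q (G.src e) - (q (G.tgt e) + L (G.label e))‖ ^ 2) →
    ∀ u v γ, ‖p u - (p v + L γ)‖ ^ 2 = ‖q u - (q v + L γ)‖ ^ 2

/-- Periodic rigidity in `ℝ^d`, in the form "for some generic `p` and some nonsingular `L`". -/
def PeriodicallyRigid (G : LabeledGraph V E Γ) (d : ℕ) : Prop :=
  ∃ (L : Γ →+ EuclideanSpace ℝ (Fin d)) (p : V → EuclideanSpace ℝ (Fin d)),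
    Nonsingular L ∧ Generic L p ∧ G.LPeriodicallyRigid L p

/-- Periodic rigidity in `ℝ^d`, in the form "for any generic `p` and any nonsingular `L`". -/
def PeriodicallyRigidAny (G : LabeledGraph V E Γ) (d : ℕ) : Prop :=
  ∀ (L : Γ →+ EuclideanSpace ℝ (Fin d)) (p : V → EuclideanSpace ℝ (Fin d)),
    Nonsingular L → Generic L p → G.LPeriodicallyRigid L p

/-- Redundant periodic rigidity in `ℝ^d` ("some" form): `G - e` is periodically rigid for
every edge `e`. -/
def RedundantlyPeriodicallyRigid (G : LabeledGraph V E Γ) (d : ℕ) : Prop :=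
  ∀ e, (G.deleteEdge e).PeriodicallyRigid d

/-- Redundant periodic rigidity in `ℝ^d` ("any" form). -/
def RedundantlyPeriodicallyRigidAny (G : LabeledGraph V E Γ) (d : ℕ) : Prop :=
  ∀ e, (G.deleteEdge e).PeriodicallyRigidAny d

/-! ### The count matroid -/

/-- Independence in the count matroid: `|F| ≤ 2|V(F)| - 2` for every nonempty `F ⊆ I`, and
`|F| ≤ 2|V(F)| - 3` for every nonempty balanced `F ⊆ I`. -/
def CountIndep (G : LabeledGraph V E Γ) (I : Set E) : Prop :=
  ∀ F ⊆ I, F.Nonempty →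
    F.ncard + 2 ≤ 2 * (G.vertexSet F).ncard ∧
    (G.Balanced F → F.ncard + 3 ≤ 2 * (G.vertexSet F).ncard)

/-- `φ` is a potential for the labels on `F`. -/
def IsPotential (G : LabeledGraph V E Γ) (F : Set E) (φ : V → Γ) : Prop :=
  ∀ e ∈ F, G.label e = φ (G.src e) - φ (G.tgt e)

theorem HasWalk.trans {G : LabeledGraph V E Γ} {F : Set E} {u v w : V} {g h : Γ}
    (h₁ : G.HasWalk F u v g) (h₂ : G.HasWalk F v w h) : G.HasWalk F u w (g + h) := by
  induction h₁ with
  | nil => simpa using h₂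
  | forward he _ ih => rw [add_assoc]; exact .forward he (ih h₂)
  | backward he _ ih => rw [add_assoc]; exact .backward he (ih h₂)

theorem HasWalk.symm {G : LabeledGraph V E Γ} {F : Set E} {u v : V} {g : Γ}
    (h₁ : G.HasWalk F u v g) : G.HasWalk F v u (-g) := by
  induction h₁ with
  | nil => simpa using HasWalk.nil _
  | @forward e he w g _ ih =>
    have := ih.trans (.backward he (.nil _))
    rwa [add_zero, ← neg_add_rev] at this
  | @backward e he w g _ ih =>
    have := ih.trans (.forward he (.nil _))
    rwa [add_zero, ← neg_neg (G.label e), ← neg_add_rev] at this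

theorem balanced_iff_potential (G : LabeledGraph V E Γ) (F : Set E) :
    G.Balanced F ↔ ∃ φ, G.IsPotential F φ := by
  constructor
  · intro hF
    let s : Setoid V :=
      { r := fun u v => ∃ g, G.HasWalk F u v g
        iseqv :=
          { refl := fun v => ⟨0, .nil v⟩
            symm := fun ⟨g, h⟩ => ⟨-g, h.symm⟩
            trans := fun ⟨g, h⟩ ⟨g', h'⟩ => ⟨g + g', h.trans h'⟩ } }
    have hrep : ∀ v, ∃ g, G.HasWalk F v (Quotient.mk s v).out g := fun v =>
      s.iseqv.symm (Quotient.mk_out (s := s) v)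
    choose φ hφ using hrep
    refine ⟨φ, fun e he => ?_⟩
    have hq : Quotient.mk s (G.src e) = Quotient.mk s (G.tgt e) :=
      Quotient.sound ⟨_, .forward he (.nil _)⟩
    have h1 := hφ (G.src e)
    rw [hq] at h1
    have h2 := HasWalk.forward he (hφ (G.tgt e))
    have h3 := hF _ _ (h2.trans h1.symm)
    rw [← sub_eq_zero, ← h3]
    abel
  · rintro ⟨φ, hφ⟩ v g h
    have key : ∀ u w g, G.HasWalk F u w g → g = φ u - φ w := by
      intro u w g h
      induction h with
      | nil => simp
      | forward he _ ih => rw [hφ _ he, ih]; abel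
      | backward he _ ih => rw [hφ _ he, ih]; abel
    simpa using key _ _ _ h

theorem IsPotential.mono {G : LabeledGraph V E Γ} {F F' : Set E} {φ : V → Γ}
    (h : G.IsPotential F φ) (hF : F' ⊆ F) : G.IsPotential F' φ := fun e he => h e (hF he)

theorem Balanced.mono {G : LabeledGraph V E Γ} {F F' : Set E}
    (h : G.Balanced F) (hF : F' ⊆ F) : G.Balanced F' := by
  rw [balanced_iff_potential] at *
  obtain ⟨φ, hφ⟩ := h
  exact ⟨φ, hφ.mono hF⟩

theorem vertexSet_mono (G : LabeledGraph V E Γ) {F F' : Set E} (h : F' ⊆ F) :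
    G.vertexSet F' ⊆ G.vertexSet F := fun _ ⟨e, he, h'⟩ => ⟨e, h he, h'⟩

theorem vertexSet_union (G : LabeledGraph V E Γ) (F F' : Set E) :
    G.vertexSet (F ∪ F') = G.vertexSet F ∪ G.vertexSet F' := by
  ext v; simp only [vertexSet, Set.mem_ofPred_eq, Set.mem_union]; aesop

theorem src_mem_vertexSet (G : LabeledGraph V E Γ) {F : Set E} {e : E} (h : e ∈ F) :
    G.src e ∈ G.vertexSet F := ⟨e, h, .inl rfl⟩

theorem tgt_mem_vertexSet (G : LabeledGraph V E Γ) {F : Set E} {e : E} (h : e ∈ F) :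
    G.tgt e ∈ G.vertexSet F := ⟨e, h, .inr rfl⟩

theorem countIndep_mono {G : LabeledGraph V E Γ} {I J : Set E} (hJ : G.CountIndep J)
    (h : I ⊆ J) : G.CountIndep I := fun F hF => hJ F (hF.trans h)

theorem balanced_union {G : LabeledGraph V E Γ} {A B : Set E} {φ φ' : V → Γ}
    (h : G.IsPotential A φ) (h' : G.IsPotential B φ') {c : Γ}
    (hc : ∀ v ∈ G.vertexSet A ∩ G.vertexSet B, φ v - φ' v = c) : G.Balanced (A ∪ B) := by
  classical
  rw [balanced_iff_potential]
  have hval : ∀ v ∈ G.vertexSet B,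
      (if v ∈ G.vertexSet A then φ v else φ' v + c) = φ' v + c := by
    intro v hv
    split_ifs with hA
    · rw [← hc v ⟨hA, hv⟩]; abel
    · rfl
  refine ⟨fun v => if v ∈ G.vertexSet A then φ v else φ' v + c, ?_⟩
  rintro e (he | he)
  · simp only [G.src_mem_vertexSet he, G.tgt_mem_vertexSet he, if_true]
    exact h e he
  · simp only
    rw [hval _ (G.src_mem_vertexSet he), hval _ (G.tgt_mem_vertexSet he), h' e he]
    abel

variable [Finite V] [Finite E]

/-- Two potentials of a dense enough independent balanced set differ by a constant. -/
theorem potential_unique {G : LabeledGraph V E Γ} {I F : Set E} (hI : G.CountIndep I)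
    (hFI : F ⊆ I) (hF : F.Nonempty) {φ φ' : V → Γ} (h : G.IsPotential F φ)
    (h' : G.IsPotential F φ') {W : Set V} (hW : G.vertexSet F ⊆ W)
    (hc : 2 * W.ncard < F.ncard + 5) : ∃ c, ∀ v ∈ W, φ v - φ' v = c := by
  by_contra! hcon
  obtain ⟨e₀, he₀⟩ := hF
  set c := φ (G.src e₀) - φ' (G.src e₀) with hcdef
  have hdiff : ∀ e ∈ F, φ (G.src e) - φ' (G.src e) = φ (G.tgt e) - φ' (G.tgt e) := by
    intro e he
    have h1 := h e he
    rw [h' e he] at h1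
    rw [sub_eq_sub_iff_add_eq_add] at h1 ⊢
    rw [← h1, add_comm]
  let X : Set V := {v | v ∈ W ∧ φ v - φ' v = c}
  let Y : Set V := {v | v ∈ W ∧ φ v - φ' v ≠ c}
  have hXY : X.ncard + Y.ncard = W.ncard := by
    rw [← Set.ncard_union_eq]
    · congr 1; ext v; simp only [X, Y, Set.mem_union, Set.mem_ofPred_eq]; tauto
    · rw [Set.disjoint_left]; rintro v ⟨_, h1⟩ ⟨_, h2⟩; exact h2 h1
  let A : Set E := {e | e ∈ F ∧ φ (G.src e) - φ' (G.src e) = c}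
  let B : Set E := {e | e ∈ F ∧ φ (G.src e) - φ' (G.src e) ≠ c}
  have hAB : A.ncard + B.ncard = F.ncard := by
    rw [← Set.ncard_union_eq]
    · congr 1; ext v; simp only [A, B, Set.mem_union, Set.mem_ofPred_eq]; tauto
    · rw [Set.disjoint_left]; rintro v ⟨_, h1⟩ ⟨_, h2⟩; exact h2 h1
  have hAF : A ⊆ F := fun e he => he.1
  have hBF : B ⊆ F := fun e he => he.1
  have hbal : ∀ S ⊆ F, G.Balanced S := fun S hS =>
    (G.balanced_iff_potential S).2 ⟨φ, h.mono hS⟩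
  have hAX : (G.vertexSet A).ncard ≤ X.ncard := by
    refine Set.ncard_le_ncard ?_ (Set.toFinite _)
    rintro v ⟨e, he, rfl | rfl⟩
    · exact ⟨hW (G.src_mem_vertexSet he.1), he.2⟩
    · exact ⟨hW (G.tgt_mem_vertexSet he.1), (hdiff e he.1) ▸ he.2⟩
  have hBY : (G.vertexSet B).ncard ≤ Y.ncard := by
    refine Set.ncard_le_ncard ?_ (Set.toFinite _)
    rintro v ⟨e, he, rfl | rfl⟩
    · exact ⟨hW (G.src_mem_vertexSet he.1), he.2⟩
    · exact ⟨hW (G.tgt_mem_vertexSet he.1), (hdiff e he.1) ▸ he.2⟩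
  have h1 := (hI A (hAF.trans hFI) ⟨e₀, he₀, rfl⟩).2 (hbal A hAF)
  have hY : 0 < Y.ncard := by
    obtain ⟨v, hv, hne⟩ := hcon c
    exact (Set.ncard_pos (Set.toFinite _)).2 ⟨v, hv, hne⟩
  rcases B.eq_empty_or_nonempty with hB | hB
  · rw [hB, Set.ncard_empty] at hAB
    omega
  · have h2 := (hI B (hBF.trans hFI) hB).2 (hbal B hBF)
    omega

/-- A nonempty edge set attaining its count. -/
def Tight (G : LabeledGraph V E Γ) (T : Set E) : Prop :=
  T.Nonempty ∧ (G.Balanced T → 2 * (G.vertexSet T).ncard = T.ncard + 3) ∧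
    (¬ G.Balanced T → 2 * (G.vertexSet T).ncard = T.ncard + 2)

/-- The ends of `e` lie in `V(T)`, and `e` does not change whether `T` is balanced. -/
def Spans (G : LabeledGraph V E Γ) (T : Set E) (e : E) : Prop :=
  G.src e ∈ G.vertexSet T ∧ G.tgt e ∈ G.vertexSet T ∧
    (G.Balanced T → G.Balanced (insert e T))

theorem Tight.union {G : LabeledGraph V E Γ} {I A B : Set E} (hI : G.CountIndep I)
    (hAI : A ⊆ I) (hBI : B ⊆ I) (hA : G.Tight A) (hB : G.Tight B) (hAB : (A ∩ B).Nonempty) :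
    G.Tight (A ∪ B) := by
  have hne : (A ∪ B).Nonempty := hA.1.inl
  have hU := hI (A ∪ B) (Set.union_subset hAI hBI) hne
  have hN := hI (A ∩ B) (Set.inter_subset_left.trans hAI) hAB
  have hE := Set.ncard_union_add_ncard_inter A B
  have hV := Set.ncard_union_add_ncard_inter (G.vertexSet A) (G.vertexSet B)
  rw [← G.vertexSet_union] at hV
  have hsub : G.vertexSet (A ∩ B) ⊆ G.vertexSet A ∩ G.vertexSet B :=
    Set.subset_inter (G.vertexSet_mono Set.inter_subset_left)
      (G.vertexSet_mono Set.inter_subset_right)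
  have hle := Set.ncard_le_ncard hsub (Set.toFinite _)
  refine ⟨hne, fun hb => ?_, fun hb => ?_⟩
  · have hbA := hb.mono (Set.subset_union_left (s := A) (t := B))
    have hbB := hb.mono (Set.subset_union_right (s := A) (t := B))
    have h1 := hA.2.1 hbA
    have h2 := hB.2.1 hbB
    have h3 := hN.2 (hbA.mono Set.inter_subset_left)
    have h4 := hU.2 hb
    omega
  · have h4 := hU.1
    by_cases hbA : G.Balanced A
    · have h1 := hA.2.1 hbA
      by_cases hbB : G.Balanced B
      · have h2 := hB.2.1 hbB
        obtain ⟨φ, hφ⟩ := (G.balanced_iff_potential A).1 hbA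
        obtain ⟨φ', hφ'⟩ := (G.balanced_iff_potential B).1 hbB
        by_cases hlt : 2 * (G.vertexSet A ∩ G.vertexSet B).ncard < (A ∩ B).ncard + 5
        · obtain ⟨c, hc⟩ := potential_unique hI (Set.inter_subset_left.trans hAI) hAB
            (hφ.mono Set.inter_subset_left) (hφ'.mono Set.inter_subset_right) hsub hlt
          exact absurd (balanced_union hφ hφ' hc) hb
        · omega
      · have h2 := hB.2.2 hbB
        have h3 := hN.2 (hbA.mono Set.inter_subset_left)
        omega
    · have h1 := hA.2.2 hbA
      by_cases hbB : G.Balanced B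
      · have h2 := hB.2.1 hbB
        have h3 := hN.2 (hbB.mono Set.inter_subset_right)
        omega
      · have h2 := hB.2.2 hbB
        have h3 := hN.1
        omega

/-- A potential of a tight balanced set extends to every spanned edge. -/
theorem Spans.label_eq {G : LabeledGraph V E Γ} {I T : Set E} {e : E} (hI : G.CountIndep I)
    (hTI : T ⊆ I) (hT : G.Tight T) {φ : V → Γ} (hφ : G.IsPotential T φ) (he : G.Spans T e) :
    G.label e = φ (G.src e) - φ (G.tgt e) := by
  have hb : G.Balanced T := (G.balanced_iff_potential T).2 ⟨φ, hφ⟩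
  obtain ⟨φ', hφ'⟩ := (G.balanced_iff_potential _).1 (he.2.2 hb)
  have h1 := hT.2.1 hb
  obtain ⟨c, hc⟩ := potential_unique hI hTI hT.1 hφ (hφ'.mono (Set.subset_insert _ _))
    (W := G.vertexSet T) subset_rfl (by omega)
  rw [hφ' e (Set.mem_insert _ _)]
  have h2 := (hc _ he.1).trans (hc _ he.2.1).symm
  rw [sub_eq_sub_iff_add_eq_add] at h2 ⊢
  rw [add_comm, ← h2, add_comm]

theorem Spans.mono {G : LabeledGraph V E Γ} {I F T : Set E} {e : E} (hI : G.CountIndep I)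
    (hTI : T ⊆ I) (hFT : F ⊆ T) (hF : G.Tight F) (he : G.Spans F e) : G.Spans T e := by
  refine ⟨G.vertexSet_mono hFT he.1, G.vertexSet_mono hFT he.2.1, fun hb => ?_⟩
  obtain ⟨φ, hφ⟩ := (G.balanced_iff_potential T).1 hb
  refine (G.balanced_iff_potential _).2 ⟨φ, ?_⟩
  rintro f (rfl | hf)
  · exact he.label_eq hI (hFT.trans hTI) hF (hφ.mono hFT)
  · exact hφ f hf

theorem exists_tight_of_not_indep {G : LabeledGraph V E Γ} {I : Set E} (hI : G.CountIndep I)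
    {e : E} (he : ¬ G.CountIndep (insert e I)) : ∃ F ⊆ I, G.Tight F ∧ G.Spans F e := by
  unfold CountIndep at he
  push Not at he
  obtain ⟨X, hX, hXne, hviol⟩ := he
  have heX : e ∈ X := by
    by_contra heX
    have := hI X (fun f hf => (hX hf).resolve_left (fun h => heX (h ▸ hf))) hXne
    obtain ⟨hb, hlt⟩ := hviol this.1
    exact absurd (this.2 hb) (by omega)
  let F := X \ {e}
  have hins : insert e F = X := by simp [F, Set.insert_eq_of_mem heX]
  have hFI : F ⊆ I := fun f hf => (hX hf.1).resolve_left hf.2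
  have hcard : X.ncard = F.ncard + 1 := (Set.ncard_sdiff_singleton_add_one heX).symm
  have hFX : F ⊆ X := Set.sdiff_subset
  have hVle := Set.ncard_le_ncard (G.vertexSet_mono hFX) (Set.toFinite _)
  have hFne : F.Nonempty := by
    by_contra hF
    rw [Set.not_nonempty_iff_eq_empty] at hF
    have h2 : ({G.src e, G.tgt e} : Set V).ncard ≤ (G.vertexSet X).ncard := by
      refine Set.ncard_le_ncard ?_ (Set.toFinite _)
      rintro v (rfl | rfl)
      · exact G.src_mem_vertexSet heX
      · exact G.tgt_mem_vertexSet heX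
    rw [Set.ncard_pair (G.loopless e)] at h2
    rw [hF, Set.ncard_empty] at hcard
    obtain ⟨_, h3⟩ := hviol (by omega)
    omega
  have hFc := hI F hFI hFne
  have hbX : G.Balanced X → G.Balanced F := fun h => h.mono hFX
  have main : (G.vertexSet F).ncard = (G.vertexSet X).ncard ∧ G.Tight F ∧
      (G.Balanced F → G.Balanced X) := by
    by_cases hb : G.Balanced X
    · have h1 := hFc.2 (hbX hb)
      have h2 : 2 * (G.vertexSet X).ncard < X.ncard + 3 := by
        by_contra hlt
        have := (hviol (by omega)).2
        omega
      refine ⟨by omega, ⟨hFne, fun _ => by omega, fun h => absurd (hbX hb) h⟩, fun _ => hb⟩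
    · have h2 : 2 * (G.vertexSet X).ncard < X.ncard + 2 := by
        by_contra hlt
        exact hb (hviol (by omega)).1
      by_cases hbF : G.Balanced F
      · have h1 := hFc.2 hbF
        omega
      · have h1 := hFc.1
        exact ⟨by omega, ⟨hFne, fun h => absurd h hbF, fun _ => by omega⟩, fun h => absurd h hbF⟩
  obtain ⟨hVeq, hT, hbal⟩ := main
  have hV : G.vertexSet F = G.vertexSet X :=
    Set.eq_of_subset_of_ncard_le (G.vertexSet_mono hFX) hVeq.ge (Set.toFinite _)
  refine ⟨F, hFI, hT, ?_, ?_, ?_⟩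
  · rw [hV]; exact G.src_mem_vertexSet heX
  · rw [hV]; exact G.tgt_mem_vertexSet heX
  · rw [hins]; exact hbal

/-- An independent set contained in the span of a tight set `T` has at most `|T|` elements. -/
theorem ncard_le_of_spans {G : LabeledGraph V E Γ} {I T K : Set E} (hI : G.CountIndep I)
    (hTI : T ⊆ I) (hT : G.Tight T) (hK : G.CountIndep K) (hs : ∀ e ∈ K, G.Spans T e) :
    K.ncard ≤ T.ncard := by
  rcases K.eq_empty_or_nonempty with rfl | hKne
  · simp
  have hV : (G.vertexSet K).ncard ≤ (G.vertexSet T).ncard := by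
    refine Set.ncard_le_ncard ?_ (Set.toFinite _)
    rintro v ⟨e, he, rfl | rfl⟩
    · exact (hs e he).1
    · exact (hs e he).2.1
  have h1 := hK K subset_rfl hKne
  by_cases hb : G.Balanced T
  · obtain ⟨φ, hφ⟩ := (G.balanced_iff_potential T).1 hb
    have h2 := h1.2 ((G.balanced_iff_potential K).2
      ⟨φ, fun e he => (hs e he).label_eq hI hTI hT hφ⟩)
    have h3 := hT.2.1 hb
    omega
  · have h2 := h1.1
    have h3 := hT.2.2 hb
    omega

theorem countIndep_augment (G : LabeledGraph V E Γ) {I J : Set E} (hI : G.CountIndep I)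
    (hJ : G.CountIndep J) (hlt : I.ncard < J.ncard) :
    ∃ e ∈ J, e ∉ I ∧ G.CountIndep (insert e I) := by
  classical
  have := Fintype.ofFinite E
  by_contra! hcon
  let P : Set E → Prop := fun T => T ⊆ I ∧ G.Tight T
  let 𝒯 : Finset (Set E) := Finset.univ.filter (fun T => Maximal P T)
  have hmem : ∀ T, T ∈ 𝒯 ↔ Maximal P T := fun T => by simp [𝒯]
  have hext : ∀ F, P F → ∃ T ∈ 𝒯, F ⊆ T := fun F hF => by
    obtain ⟨T, hle, hT⟩ := (Set.toFinite {T | P T}).exists_le_maximal hF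
    exact ⟨T, (hmem T).2 hT, hle⟩
  have hdisj : ∀ T ∈ 𝒯, ∀ T' ∈ 𝒯, T ≠ T' → Disjoint T T' := by
    intro T hT T' hT' hne
    rw [Set.disjoint_iff_inter_eq_empty]
    by_contra hnemp
    rw [← Ne, ← Set.nonempty_iff_ne_empty] at hnemp
    rw [hmem] at hT hT'
    have hU : P (T ∪ T') := ⟨Set.union_subset hT.prop.1 hT'.prop.1,
      Tight.union hI hT.prop.1 hT'.prop.1 hT.prop.2 hT'.prop.2 hnemp⟩
    exact hne ((hT.eq_of_subset hU Set.subset_union_left).trans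
      (hT'.eq_of_subset hU Set.subset_union_right).symm)
  let R : Finset E := I.toFinset.filter (fun e => ∀ T ∈ 𝒯, e ∉ T)
  have hJsub : J.toFinset ⊆
      R ∪ 𝒯.biUnion (fun T => {e ∈ J.toFinset | G.Spans T e}) := by
    intro e he
    have heJ : e ∈ J := by simpa using he
    rw [Finset.mem_union, Finset.mem_biUnion]
    by_cases heI : e ∈ I
    · by_cases hT : ∃ T ∈ 𝒯, e ∈ T
      · obtain ⟨T, hT, heT⟩ := hT
        refine .inr ⟨T, hT, ?_⟩
        simp only [Finset.mem_filter]
        exact ⟨he, G.src_mem_vertexSet heT, G.tgt_mem_vertexSet heT,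
          fun h => by rwa [Set.insert_eq_of_mem heT]⟩
      · push Not at hT
        exact .inl (by simp only [R, Finset.mem_filter, Set.mem_toFinset]; exact ⟨heI, hT⟩)
    · obtain ⟨F, hFI, hF, hFe⟩ := exists_tight_of_not_indep hI (hcon e heJ heI)
      obtain ⟨T, hT, hFT⟩ := hext F ⟨hFI, hF⟩
      refine .inr ⟨T, hT, ?_⟩
      simp only [Finset.mem_filter]
      exact ⟨he, hFe.mono hI ((hmem T).1 hT).prop.1 hFT hF⟩
  have hJcard : J.ncard ≤ R.card + ∑ T ∈ 𝒯, T.ncard := by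
    rw [Set.ncard_eq_toFinset_card']
    refine (Finset.card_le_card hJsub).trans ((Finset.card_union_le _ _).trans ?_)
    refine Nat.add_le_add_left (Finset.card_biUnion_le.trans (Finset.sum_le_sum ?_)) _
    intro T hT
    have hp := ((hmem T).1 hT).prop
    rw [← Set.ncard_coe_finset]
    refine ncard_le_of_spans hI hp.1 hp.2 (countIndep_mono hJ ?_) ?_
    · intro e he; simp at he; exact he.1
    · intro e he; simp at he; exact he.2
  have hIcard : R.card + ∑ T ∈ 𝒯, T.ncard ≤ I.ncard := by
    have h1 : ∑ T ∈ 𝒯, T.ncard = (𝒯.biUnion (fun T => T.toFinset)).card := by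
      rw [Finset.card_biUnion]
      · exact Finset.sum_congr rfl fun T _ => Set.ncard_eq_toFinset_card' T
      · intro T hT T' hT' hne
        exact Set.disjoint_toFinset.2 (hdisj T hT T' hT' hne)
    rw [h1, ← Finset.card_union_of_disjoint, Set.ncard_eq_toFinset_card']
    · refine Finset.card_le_card ?_
      intro e he
      rw [Finset.mem_union, Finset.mem_biUnion] at he
      rcases he with he | ⟨T, hT, he⟩
      · exact (Finset.mem_filter.1 he).1
      · exact Set.mem_toFinset.2 (((hmem T).1 hT).prop.1 (Set.mem_toFinset.1 he))
    · rw [Finset.disjoint_left]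
      intro e he he'
      obtain ⟨T, hT, he'⟩ := Finset.mem_biUnion.1 he'
      exact (Finset.mem_filter.1 he).2 T hT (Set.mem_toFinset.1 he')
  omega

/-- The restriction to `E(G)` of the periodic count matroid on the complete `Γ`-labeled graph
on `V`: the matroid on `E(G)` whose independent sets are those satisfying the counts. -/
def countMatroid (G : LabeledGraph V E Γ) : Matroid E :=
  (IndepMatroid.ofFinite (Set.toFinite Set.univ) G.CountIndep
    (fun _ hF hne => absurd (Set.subset_empty_iff.1 hF) hne.ne_empty)
    (fun _ _ hJ hIJ => countIndep_mono hJ hIJ)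
    (fun _ _ hI hJ h => G.countIndep_augment hI hJ h)
    (fun _ _ => Set.subset_univ _)).matroid

/-- A matroid is connected if it has at least two elements and any two distinct elements lie in
a common circuit. -/
def MatroidConnected {α : Type*} (M : Matroid α) : Prop :=
  M.E.Nontrivial ∧ ∀ e ∈ M.E, ∀ f ∈ M.E, e = f ∨ ∃ C, M.IsCircuit C ∧ e ∈ C ∧ f ∈ C

/-- `G` is M-connected. -/
def MConnected (G : LabeledGraph V E Γ) : Prop := MatroidConnected G.countMatroid

end LabeledGraph

/-!
A framework `p : V → ℝ²` has the derivatives of the squared edge lengths as rows of its rigidity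
matrix. At a generic framework a set of rows is linearly independent exactly when it is independent
in the count matroid. Sufficiency of the counts is Lovász's lemma on a hyperplane in general
position relative to the planes spanned by the two coordinates of each edge vector, and independence
at some framework passes to generic ones because Gram determinants are polynomials in `p`. Also,
a generic framework is rigid exactly when all its infinitesimal motions are translations: a
nontrivial motion integrates to a curve by the implicit function theorem, as the rank is locally
constant, and without one the quadratic error of a small displacement is too small to compensate
its linear effect.

Circuits of the count matroid have only trivial motions, and so has a union of such sets sharing an
edge. If `G` is M-connected, then every edge lies in a circuit, so deleting it leaves the motions
unchanged and all of them are translations; and no circuit crosses a cut vertex, because the counts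
of its two sides add up. Conversely, redundant rigidity puts every edge into a circuit. Each
matroid component `D` then has only trivial motions. If there were several, `D` would share at least
two of its vertices with the others, by 2-connectivity, and at least three if it is balanced, as it
is not a `(0, 2)`-block. So its rank is at least `|V(D)|` plus the number of its unshared vertices,
and these bounds add up to at least `2 |V|`, while the rank is at most `2 |V| - 2`.
-/

theorem exists_isCircuit_mem_mem_of_inter_nonempty {α : Type*} {M : Matroid α} [M.Finitary]
    {C₁ C₂ : Set α} {e g : α} (h₁ : M.IsCircuit C₁) (h₂ : M.IsCircuit C₂) (he : e ∈ C₁)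
    (hg : g ∈ C₂) (hne : (C₁ ∩ C₂).Nonempty) : ∃ C, M.IsCircuit C ∧ e ∈ C ∧ g ∈ C := by
  induction hn : (C₁ ∪ C₂).ncard using Nat.strong_induction_on generalizing C₂ with
  | _ n ih =>
    by_cases heC : e ∈ C₂
    · exact ⟨C₂, h₂, heC, hg⟩
    by_cases hgC : g ∈ C₁
    · exact ⟨C₁, h₁, he, hgC⟩
    obtain ⟨f, hf₁, hf₂⟩ := hne
    obtain ⟨C₃, hC₃, h₃, heC₃⟩ := h₁.strong_elimination h₂ hf₁ hf₂ he heC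
    by_cases hgC₃ : g ∈ C₃
    · exact ⟨C₃, h₃, heC₃, hgC₃⟩
    obtain ⟨x, hx₃, hx₁⟩ : ∃ x ∈ C₃, x ∉ C₁ := by
      by_contra! hcon
      exact (hC₃ (h₃.eq_of_subset_isCircuit h₁ hcon ▸ hf₁)).2 rfl
    have hx₂ : x ∈ C₂ := (hC₃ hx₃).1.resolve_left hx₁
    -- Eliminating `x` from `C₂` gives a circuit through `g` that meets `C₁`, and the induction
    -- goes through because its union with `C₁` misses `x`.
    obtain ⟨C₄, hC₄, h₄, hgC₄⟩ := h₂.strong_elimination h₃ hx₂ hx₃ hg hgC₃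
    obtain ⟨y, hy₄, hy₂⟩ : ∃ y ∈ C₄, y ∉ C₂ := by
      by_contra! hcon
      exact (hC₄ (h₄.eq_of_subset_isCircuit h₂ hcon ▸ hx₂)).2 rfl
    have hy₁ : y ∈ C₁ := (hC₃ ((hC₄ hy₄).1.resolve_left hy₂)).1.resolve_right hy₂
    have hss : C₁ ∪ C₄ ⊂ C₁ ∪ C₂ := by
      refine (Set.ssubset_iff_of_subset ?_).2 ⟨x, .inr hx₂, ?_⟩
      · exact Set.union_subset Set.subset_union_left fun z hz =>
          (hC₄ hz).1.elim .inr fun h => (hC₃ h).1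
      · rintro (h | h)
        · exact hx₁ h
        · exact (hC₄ h).2 rfl
    have hlt := Set.ncard_lt_ncard hss (h₁.finite.union h₂.finite)
    exact ih _ (hn ▸ hlt) h₄ hgC₄ ⟨y, hy₁, hy₄⟩ rfl

/-- The relation of lying in a common circuit; its classes are the connected components of `M`. -/
def circuitSetoid {α : Type*} (M : Matroid α) [M.Finitary] : Setoid α where
  r e f := e = f ∨ ∃ C, M.IsCircuit C ∧ e ∈ C ∧ f ∈ C
  iseqv := {
    refl := fun _ => .inl rfl
    symm := by
      rintro e f (rfl | ⟨C, hC, he, hf⟩)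
      · exact .inl rfl
      · exact .inr ⟨C, hC, hf, he⟩
    trans := by
      rintro e f g (rfl | ⟨C, hC, he, hf⟩) (rfl | ⟨C', hC', hf', hg⟩)
      · exact .inl rfl
      · exact .inr ⟨C', hC', hf', hg⟩
      · exact .inr ⟨C, hC, he, hf⟩
      · exact .inr (exists_isCircuit_mem_mem_of_inter_nonempty hC hC' he hg ⟨f, hf, hf'⟩) }

/-! ### Hyperplanes in general position -/

section Hyperplane

variable {K U : Type*} [Field K] [AddCommGroup U] [Module K U]

theorem exists_ne_zero_linearIndependent_add_smul [Infinite K] {ι : Type*} [Finite ι] {v : ι → U}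
    (hv : LinearIndependent K v) (w : ι → U) :
    ∃ ε : K, ε ≠ 0 ∧ LinearIndependent K fun i => v i + ε • w i := by
  classical
  have := Fintype.ofFinite ι
  obtain ⟨T, hT⟩ := LinearMap.exists_leftInverse_of_injective
    (Fintype.linearCombination K v) (LinearMap.ker_eq_bot.2 hv.fintypeLinearCombination_injective)
  have hTv (i) : T (v i) = Pi.single i 1 := by
    simpa [Fintype.linearCombination_apply_single] using LinearMap.congr_fun hT (Pi.single i 1)
  let W : Matrix ι ι K := Matrix.of fun i => -T (w i)
  have hW : W.charpolyRev ≠ 0 := fun h => by simpa [h] using W.eval_charpolyRev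
  obtain ⟨ε, hε⟩ := (insert 0 W.charpolyRev.roots.toFinset).exists_notMem
  rw [Finset.mem_insert, not_or, Multiset.mem_toFinset, Polynomial.mem_roots hW] at hε
  refine ⟨ε, hε.1, LinearIndependent.of_comp T (Matrix.linearIndependent_rows_of_det_ne_zero
    (A := Matrix.of fun i => T (v i + ε • w i)) fun hdet => hε.2 ?_)⟩
  rw [Polynomial.IsRoot, Matrix.charpolyRev, ← Polynomial.coe_evalRingHom, RingHom.map_det, ← hdet]
  congr 1
  ext i j
  rcases eq_or_ne i j with rfl | hij
  · simp [W, hTv, mul_comm (T (w i) i)]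
  · simp [W, hTv, hij, mul_comm (T (w i) j)]

theorem exists_mem_ne_zero_forall_mem_imp_le [Infinite K] {P : Submodule K U} (hP : P ≠ ⊥)
    {𝒜 : Set (Submodule K U)} (h𝒜 : 𝒜.Finite) : ∃ x ∈ P, x ≠ 0 ∧ ∀ A ∈ 𝒜, x ∈ A → P ≤ A := by
  let ℬ : Set (Submodule K P) := insert ⊥ ((·.comap P.subtype) '' {A ∈ 𝒜 | ¬ P ≤ A})
  have hℬ : ℬ.Finite := ((h𝒜.subset (Set.sep_subset _ _)).image _).insert _
  have htop : ⊤ ∉ ℬ := by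
    rintro (h | ⟨A, ⟨-, hA⟩, h⟩)
    · exact hP (Submodule.subsingleton_iff_eq_bot.1
        ((Submodule.subsingleton_iff K).1 (subsingleton_of_bot_eq_top h.symm)))
    · exact hA (Submodule.comap_subtype_eq_top.1 h)
  obtain ⟨x, hx⟩ := (Set.ne_univ_iff_exists_notMem _).1
    (Subspace.biUnion_ne_univ_of_top_notMem (s := hℬ.toFinset) (hℬ.mem_toFinset.not.2 htop))
  simp only [Set.mem_iUnion, not_exists, Set.Finite.mem_toFinset] at hx
  refine ⟨x, x.2, fun h => hx ⊥ (Set.mem_insert _ _) (by simpa using h), fun A hA hxA => ?_⟩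
  by_contra hPA
  exact hx _ (Set.mem_insert_of_mem _ ⟨A, ⟨hA, hPA⟩, rfl⟩) hxA

theorem finrank_map_mkQ_span_singleton {A : Submodule K U} {x : U} (hx : x ∉ A) :
    Module.finrank K (A.map (K ∙ x).mkQ) = Module.finrank K A := by
  have hinj : Function.Injective ((K ∙ x).mkQ.domRestrict A) := by
    rw [LinearMap.injective_domRestrict_iff, Submodule.ker_mkQ]
    exact Submodule.disjoint_span_singleton_of_notMem hx
  rw [← LinearMap.range_domRestrict, LinearMap.finrank_range_of_inj hinj]

theorem finrank_le_finrank_map_mkQ_span_singleton_add_one (A : Submodule K U)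
    [FiniteDimensional K A] (x : U) :
    Module.finrank K A ≤ Module.finrank K (A.map (K ∙ x).mkQ) + 1 := by
  have hker : Module.finrank K (((K ∙ x).mkQ.domRestrict A).ker) ≤ 1 := by
    rw [← Submodule.finrank_map_subtype_eq, LinearMap.ker_domRestrict, Submodule.ker_mkQ]
    exact (Submodule.finrank_mono (Submodule.map_comap_le _ _)).trans
      ((finrank_span_le_card ({x} : Set U)).trans_eq (by simp))
  rw [← LinearMap.range_domRestrict, ← LinearMap.finrank_range_add_finrank_ker
    ((K ∙ x).mkQ.domRestrict A)]
  lia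

/-- A vector spanning the intersection of the plane `span {a, b}` with the hyperplane `ker h`, when
this intersection is a line. -/
def kernelVec (h : Module.Dual K U) (a b : U) : U := h b • a - h a • b

theorem kernelVec_add_smul (h g : Module.Dual K U) (ε : K) (a b : U) :
    kernelVec (h + ε • g) a b = kernelVec h a b + ε • kernelVec g a b := by
  simp only [kernelVec, LinearMap.add_apply, LinearMap.smul_apply, smul_eq_mul]
  module

theorem map_kernelVec {U' : Type*} [AddCommGroup U'] [Module K U'] (f : U →ₗ[K] U')
    (h : Module.Dual K U') (a b : U) :
    f (kernelVec (h ∘ₗ f) a b) = kernelVec h (f a) (f b) := by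
  simp [kernelVec]

theorem exists_eq_smul_kernelVec {h : Module.Dual K U} {a b x y : U}
    (hx : x ∈ Submodule.span K {a, b}) (hy : y ∈ Submodule.span K {a, b}) (hhx : h x = 0)
    (hhy : h y ≠ 0) : ∃ c : K, x = c • kernelVec h a b := by
  obtain ⟨α, β, rfl⟩ := Submodule.mem_span_pair.1 hx
  obtain ⟨γ, δ, rfl⟩ := Submodule.mem_span_pair.1 hy
  set x := α • a + β • b
  set y := γ • a + δ • b
  have hxy : kernelVec h x y = (α * δ - β * γ) • kernelVec h a b := by
    simp only [kernelVec, x, y, map_add, map_smul, smul_eq_mul]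
    module
  rw [kernelVec, hhx, zero_smul, sub_zero] at hxy
  exact ⟨(h y)⁻¹ * (α * δ - β * γ), by rw [mul_smul, ← hxy, inv_smul_smul₀ hhy]⟩

theorem exists_linearIndepOn_kernelVec_and_ne_zero [Infinite K] {ι : Type*} {s : Set ι}
    (hs : s.Finite) {a b : ι → U} {h : Module.Dual K U}
    (hh : LinearIndepOn K (fun i => kernelVec h (a i) (b i)) s) {y : U} (hy : y ≠ 0) :
    ∃ g : Module.Dual K U, LinearIndepOn K (fun i => kernelVec g (a i) (b i)) s ∧ g y ≠ 0 := by
  by_cases hhy : h y = 0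
  · have := hs.to_subtype
    obtain ⟨g, hg⟩ := Module.Projective.exists_dual_ne_zero K hy
    obtain ⟨ε, hε, hli⟩ := exists_ne_zero_linearIndependent_add_smul hh
      fun i => kernelVec g (a i) (b i)
    refine ⟨h + ε • g, ?_, ?_⟩
    · simpa only [LinearIndepOn, kernelVec_add_smul] using hli
    · simpa [hhy] using ⟨hε, hg⟩
  · exact ⟨h, hh, hhy⟩

theorem linearIndepOn_insert_of_mkQ {ι : Type*} {v : ι → U} {x : U} (hx : x ≠ 0) {s : Set ι}
    {j : ι} {c : K} (hj : x = c • v j) (hs : LinearIndepOn K ((K ∙ x).mkQ ∘ v) s) :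
    LinearIndepOn K v (insert j s) := by
  refine LinearIndepOn.insert (LinearIndependent.of_comp _ hs) fun hmem => hx ?_
  have hdisj := Submodule.range_ker_disjoint (f := (K ∙ x).mkQ) (v := fun i : s => v i) hs
  rw [Submodule.ker_mkQ, ← Set.image_eq_range] at hdisj
  exact Submodule.disjoint_def.1 hdisj x (hj ▸ Submodule.smul_mem _ c hmem)
    (Submodule.mem_span_singleton_self x)

/-- Projecting from `x` lowers the dimension of the span of the planes in `S` only if `x` lies in
it; then the span contains the plane `span {a j, b j}` too, so it has one dimension to spare. -/
theorem card_add_one_le_finrank_span_mkQ {ι : Type*} [DecidableEq ι] {S : Finset ι} {j : ι}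
    (hj : j ∉ S) {a b : ι → U} {x : U}
    (hx : x ∈ Submodule.span K (a '' S ∪ b '' S) →
      Submodule.span K {a j, b j} ≤ Submodule.span K (a '' S ∪ b '' S))
    (hS : S.card + 1 ≤ Module.finrank K (Submodule.span K (a '' S ∪ b '' S)))
    (hjS : (insert j S).card + 1 ≤ Module.finrank K
      (Submodule.span K (a '' (insert j S : Finset ι) ∪ b '' (insert j S : Finset ι)))) :
    S.card + 1 ≤ Module.finrank K (Submodule.span K
      ((fun i => (K ∙ x).mkQ (a i)) '' S ∪ (fun i => (K ∙ x).mkQ (b i)) '' S)) := by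
  rw [← Set.image_image (K ∙ x).mkQ a, ← Set.image_image (K ∙ x).mkQ b, ← Set.image_union,
    ← Submodule.map_span]
  by_cases hxS : x ∈ Submodule.span K (a '' S ∪ b '' S)
  · have hinsert : a '' (insert j S : Finset ι) ∪ b '' (insert j S : Finset ι) =
        {a j, b j} ∪ (a '' S ∪ b '' S) := by
      rw [Finset.coe_insert, Set.image_insert_eq, Set.image_insert_eq, Set.insert_union,
        Set.union_insert, Set.insert_union, Set.singleton_union]
    rw [hinsert, Submodule.span_union, sup_eq_right.2 (hx hxS), Finset.card_insert_of_notMem hj]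
      at hjS
    have := FiniteDimensional.span_of_finite K
      ((S.finite_toSet.image a).union (S.finite_toSet.image b))
    have := finrank_le_finrank_map_mkQ_span_singleton_add_one (Submodule.span K (a '' S ∪ b '' S)) x
    omega
  · rwa [finrank_map_mkQ_span_singleton hxS]

/-- Lovász's lemma on hyperplanes in general position. -/
theorem exists_linearIndepOn_kernelVec [Infinite K] {ι : Type*} (s : Finset ι) (a b : ι → U)
    (hab : ∀ S ⊆ s, S.Nonempty →
      S.card + 1 ≤ Module.finrank K (Submodule.span K (a '' S ∪ b '' S))) :
    ∃ h : Module.Dual K U, LinearIndepOn K (fun i => kernelVec h (a i) (b i)) s := by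
  classical
  induction s using Finset.induction_on generalizing U with
  | empty => exact ⟨0, by simp⟩
  | insert j s hj ih =>
    have hP : 2 ≤ Module.finrank K (Submodule.span K {a j, b j}) := by
      have := hab {j} (by simp) (by simp)
      rwa [Finset.coe_singleton, Set.image_singleton, Set.image_singleton,
        Set.singleton_union] at this
    obtain ⟨x, hxP, hx, hxS⟩ := exists_mem_ne_zero_forall_mem_imp_le
      (P := Submodule.span K {a j, b j}) (fun h => by rw [h, finrank_bot] at hP; omega)
      (s.powerset.finite_toSet.image fun S : Finset ι => Submodule.span K (a '' S ∪ b '' S))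
    obtain ⟨h', hh'⟩ := ih (fun i => (K ∙ x).mkQ (a i)) (fun i => (K ∙ x).mkQ (b i)) fun S hS hne =>
      card_add_one_le_finrank_span_mkQ (fun h => hj (hS h))
        (hxS _ ⟨S, Finset.mem_coe.2 (Finset.mem_powerset.2 hS), rfl⟩)
        (hab S (hS.trans (Finset.subset_insert j s)) hne)
        (hab (insert j S) (Finset.insert_subset_insert j hS) (Finset.insert_nonempty j S))
    obtain ⟨y, hyP, hyx⟩ : ∃ y ∈ Submodule.span K {a j, b j}, y ∉ K ∙ x := by
      by_contra! hle
      have := (Submodule.finrank_mono hle).trans_eq (finrank_span_singleton hx)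
      omega
    obtain ⟨g, hg, hgy⟩ := exists_linearIndepOn_kernelVec_and_ne_zero s.finite_toSet hh'
      (y := (K ∙ x).mkQ y) (by simpa using hyx)
    have hgx : (g ∘ₗ (K ∙ x).mkQ) x = 0 := by
      rw [LinearMap.comp_apply, Submodule.mkQ_apply,
        (Submodule.Quotient.mk_eq_zero _).2 (Submodule.mem_span_singleton_self x), map_zero]
    obtain ⟨c, hc⟩ := exists_eq_smul_kernelVec hxP hyP hgx hgy
    refine ⟨g ∘ₗ (K ∙ x).mkQ, ?_⟩
    rw [Finset.coe_insert]
    exact linearIndepOn_insert_of_mkQ hx hc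
      (by simpa only [Function.comp_def, map_kernelVec] using hg)

end Hyperplane

theorem sum_ncard_eq_sum_ncard_setOf_mem {α β : Type*} [Fintype α] [Fintype β] (S : β → Set α) :
    ∑ x, (S x).ncard = ∑ a, {x | a ∈ S x}.ncard := by
  classical
  simp only [Set.ncard_eq_toFinset_card']
  convert Finset.sum_card_bipartiteAbove_eq_sum_card_bipartiteBelow (s := .univ) (t := .univ)
    (fun x a => a ∈ S x) using 3 <;> ext <;>
    simp [Finset.bipartiteAbove, Finset.bipartiteBelow]

theorem sum_ncard_inter_preimage_singleton {α β : Type*} [Finite α] [Fintype β] (s : Set α)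
    (f : α → β) : ∑ x, (s ∩ f ⁻¹' {x}).ncard = s.ncard := by
  classical
  have := Fintype.ofFinite α
  rw [Set.ncard_eq_toFinset_card', Finset.card_eq_sum_card_fiberwise (f := f) (t := .univ)
    fun _ _ => Finset.mem_univ _]
  refine Finset.sum_congr rfl fun x _ => ?_
  rw [Set.ncard_eq_toFinset_card']
  congr 1
  ext a
  simp

theorem not_countable_of_isTranscendenceBasis {K A : Type*} [Field K] [Countable K] [Field A]
    [Uncountable A] [Algebra K A] {s : Set A} (hs : IsTranscendenceBasis K ((↑) : s → A)) :
    ¬ s.Countable := by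
  intro hcount
  have hadjoin : Countable (Algebra.adjoin K (Set.range ((↑) : s → A))) := by
    rw [Subtype.range_coe, ← Cardinal.mk_le_aleph0_iff, ← Cardinal.lift_le_aleph0]
    refine (Algebra.lift_cardinalMk_adjoin_le K s).trans ?_
    simp [hcount.le_aleph0, Cardinal.mk_le_aleph0]
  have halg := Algebraic.countable (Algebra.adjoin K (Set.range ((↑) : s → A))) A
  exact Set.not_countable_univ (halg.mono fun x _ => hs.isAlgebraic.isAlgebraic x)

theorem span_range_eq_span_range_comp_basis {Γ W ι : Type*} [AddCommGroup Γ] [AddCommGroup W]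
    [Module ℝ W] (L : Γ →+ W) (b : Module.Basis ι ℤ Γ) :
    Submodule.span ℝ (Set.range L) = Submodule.span ℝ (Set.range (L ∘ b)) := by
  refine le_antisymm (Submodule.span_le.2 ?_)
    (Submodule.span_mono (Set.range_comp_subset_range b L))
  have h : Submodule.span ℤ (Set.range b) ≤
      ((Submodule.span ℝ (Set.range (L ∘ b))).restrictScalars ℤ).comap L.toIntLinearMap :=
    Submodule.span_le.2 (Set.range_subset_iff.2 fun i => Submodule.subset_span ⟨i, rfl⟩)
  rw [b.span_eq] at h
  exact Set.range_subset_iff.2 fun γ => h (Submodule.mem_top (x := γ))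

theorem finrank_pi_const {R M ι : Type*} [Semiring R] [StrongRankCondition R] [AddCommMonoid M]
    [Module R M] [Module.Free R M] [Module.Finite R M] [Finite ι] :
    Module.finrank R (ι → M) = Nat.card ι * Module.finrank R M := by
  have := Fintype.ofFinite ι
  simp [Module.finrank_pi_fintype]

theorem range_pi_eq_top_of_linearIndependent {K X ι : Type*} [Field K] [AddCommGroup X]
    [Module K X] [Finite ι] {f : ι → Module.Dual K X} (hf : LinearIndependent K f) :
    LinearMap.range (LinearMap.pi f) = ⊤ := by
  have := Fintype.ofFinite ι
  classical
  by_contra hne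
  obtain ⟨φ, hφ, hle⟩ := Submodule.exists_le_ker_of_lt_top _ (lt_top_iff_ne_top.2 hne)
  have hcomb : ∑ i, φ (fun j => if i = j then 1 else 0) • f i = 0 := by
    ext x
    have hx : φ (LinearMap.pi f x) = 0 := hle ⟨x, rfl⟩
    rw [LinearMap.pi_apply_eq_sum_univ φ] at hx
    simpa [mul_comm] using hx
  refine hφ (LinearMap.ext fun x => ?_)
  rw [LinearMap.pi_apply_eq_sum_univ φ]
  simp only [Fintype.linearIndependent_iff.1 hf _ hcomb, smul_zero, Finset.sum_const_zero,
    LinearMap.zero_apply]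

theorem exists_curve_of_apply_eq_zero {X Y : Type*} [NormedAddCommGroup X] [NormedSpace ℝ X]
    [CompleteSpace X] [NormedAddCommGroup Y] [NormedSpace ℝ Y] [FiniteDimensional ℝ Y]
    {f : X → Y} {f' : X →L[ℝ] Y} {a w : X} (hf : ContDiffAt ℝ 1 f a) (hf' : HasFDerivAt f f' a)
    (hsurj : f'.range = ⊤) (hw : f' w = 0) :
    ∃ c : ℝ → X, c 0 = a ∧ HasDerivAt c w 0 ∧ ContDiffAt ℝ 1 c 0 ∧
      ∀ᶠ t in 𝓝 0, f (c t) = f a := by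
  have := FiniteDimensional.complete ℝ Y
  have hs : HasStrictFDerivAt f f' a := hf.hasStrictFDerivAt' hf' one_ne_zero
  have hker := f'.ker_closedComplemented_of_finiteDimensional_range
  let φ := hs.implicitFunctionDataOfComplemented f f' hsurj hker
  have hφ : ContDiffAt ℝ 1 φ.implicitFunction.uncurry (f a, 0) := by
    have hpt : φ.prodFun φ.pt = (f a, 0) := by simp [φ]
    rw [← hpt]
    refine φ.contDiffAt_implicitFunction hf ?_ one_ne_zero
    simp only [φ, HasStrictFDerivAt.implicitFunctionDataOfComplemented]
    fun_prop
  let g : f'.ker → X := φ.implicitFunction (f a)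
  have hg₀ : g 0 = a := hs.implicitFunctionOfComplemented_apply_image hsurj hker
  have hg' : HasFDerivAt g f'.ker.subtypeL 0 :=
    (hs.to_implicitFunctionOfComplemented hsurj hker).hasFDerivAt
  have hg : ContDiffAt ℝ 1 g 0 := hφ.comp (0 : f'.ker) (contDiffAt_const.prodMk contDiffAt_id)
  have hfg : ∀ᶠ y in 𝓝 0, f (g y) = f a := (continuousAt_const.prodMk continuousAt_id).eventually
    (hs.map_implicitFunctionOfComplemented_eq hsurj hker)
  let line : ℝ → f'.ker := fun t => t • ⟨w, hw⟩
  have hline₀ : line 0 = 0 := zero_smul ℝ _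
  have hline' : HasDerivAt line ⟨w, hw⟩ 0 := by
    simpa only [one_smul] using (hasDerivAt_id' (0 : ℝ)).smul_const (⟨w, hw⟩ : f'.ker)
  have hline : ContDiffAt ℝ 1 line 0 := contDiffAt_id.smul contDiffAt_const
  rw [← hline₀] at hg₀ hg' hg hfg
  exact ⟨g ∘ line, hg₀, hg'.comp_hasDerivAt 0 hline', hg.comp 0 hline,
    hline'.continuousAt.eventually hfg⟩

/-! ### The rigidity matrix -/

namespace LabeledGraph

variable {V E Γ : Type*} [AddCommGroup Γ]

/-- The vector along the edge `e` in the periodic framework `(G, L, p)`. -/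
def edgeVec {W : Type*} [AddCommGroup W] (G : LabeledGraph V E Γ) (L : Γ →+ W)
    (p : V → W) (e : E) : W :=
  p (G.src e) - (p (G.tgt e) + L (G.label e))

section RigidityMatrix

variable {W : Type*} [NormedAddCommGroup W] [InnerProductSpace ℝ W]

/-- The row of the rigidity matrix of `(G, L, p)` at the edge `e`, as a linear functional on the
velocity assignments; up to a factor `2` it is the derivative of the squared edge length. -/
noncomputable def row (G : LabeledGraph V E Γ) (L : Γ →+ W) (p : V → W) (e : E) :
    Module.Dual ℝ (V → W) :=
  innerₗ W (G.edgeVec L p e) ∘ₗ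
    ((LinearMap.proj (G.src e) : (V → W) →ₗ[ℝ] W) - LinearMap.proj (G.tgt e))

/-- The infinitesimal motions of the subframework of `(G, L, p)` on the edge set `F`. -/
noncomputable def motions (G : LabeledGraph V E Γ) (L : Γ →+ W) (p : V → W) (F : Set E) :
    Submodule ℝ (V → W) :=
  (Submodule.span ℝ (G.row L p '' F)).dualCoannihilator

variable {G : LabeledGraph V E Γ} {L : Γ →+ W} {p : V → W} {F F' : Set E}

theorem row_apply (e : E) (m : V → W) :
    G.row L p e m = inner ℝ (G.edgeVec L p e) (m (G.src e) - m (G.tgt e)) := rfl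

theorem mem_motions {m : V → W} : m ∈ G.motions L p F ↔ ∀ e ∈ F, G.row L p e m = 0 := by
  rw [motions, ← SetLike.mem_coe, Submodule.coe_dualCoannihilator_span]
  exact Set.forall_mem_image

theorem motions_anti (h : F ⊆ F') : G.motions L p F' ≤ G.motions L p F := fun _ hm =>
  mem_motions.2 fun e he => mem_motions.1 hm e (h he)

variable [Finite V] [FiniteDimensional ℝ W]

theorem row_mem_span_iff {e : E} :
    G.row L p e ∈ Submodule.span ℝ (G.row L p '' F) ↔
      ∀ m ∈ G.motions L p F, G.row L p e m = 0 := by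
  rw [← Submodule.mem_dualAnnihilator, motions, Subspace.dualCoannihilator_dualAnnihilator_eq]

theorem ncard_add_finrank_motions [Finite E] (hF : LinearIndepOn ℝ (G.row L p) F) :
    F.ncard + Module.finrank ℝ (G.motions L p F) = Nat.card V * Module.finrank ℝ W := by
  have := Fintype.ofFinite F
  rw [← finrank_pi_const, motions,
    ← Subspace.finrank_add_finrank_dualCoannihilator_eq (Submodule.span ℝ (G.row L p '' F)),
    Set.image_eq_range, finrank_span_eq_card hF, Set.ncard_eq_toFinset_card', Set.toFinset_card]

end RigidityMatrix

section Nonsingular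

variable {d : ℕ} [Module.Free ℤ Γ] [Module.Finite ℤ Γ]

theorem Nonsingular.injective {L : Γ →+ EuclideanSpace ℝ (Fin d)} (hL : Nonsingular L) :
    Function.Injective L := by
  let b := Module.Free.chooseBasis ℤ Γ
  have hli : LinearIndependent ℝ (L ∘ b) := by
    rw [linearIndependent_iff_card_eq_finrank_span, Set.finrank,
      ← span_range_eq_span_range_comp_basis, hL, Module.finrank_eq_card_basis b]
  have hinj := b.injective_constr_of_linearIndependent (R₂ := ℤ)
    (hli.restrict_scalars (R := ℤ) fun m n h => by simpa using h)
  rwa [show b.constr ℤ (L ∘ b) = L.toIntLinearMap from b.constr_eq ℤ fun _ => rfl] at hinj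

theorem exists_nonsingular (hd : Module.finrank ℤ Γ ≤ d) :
    ∃ L : Γ →+ EuclideanSpace ℝ (Fin d), Nonsingular L := by
  let b := Module.finBasis ℤ Γ
  let c : Fin (Module.finrank ℤ Γ) → EuclideanSpace ℝ (Fin d) :=
    fun i => EuclideanSpace.basisFun (Fin d) ℝ (Fin.castLE hd i)
  have hc : LinearIndependent ℝ c :=
    (EuclideanSpace.basisFun (Fin d) ℝ).orthonormal.linearIndependent.comp _
      (Fin.castLE_injective hd)
  have hb : (b.constr ℤ c).toAddMonoidHom ∘ b = c := funext (b.constr_basis ℤ c)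
  refine ⟨(b.constr ℤ c).toAddMonoidHom, ?_⟩
  rw [Nonsingular, span_range_eq_span_range_comp_basis _ b, hb, finrank_span_eq_card hc,
    Fintype.card_fin]

end Nonsingular

section Generic

/-- The field generated by the coordinates of the values of `L`, over which generic frameworks
have algebraically independent coordinates. -/
noncomputable abbrev coordField {d : ℕ} (L : Γ →+ EuclideanSpace ℝ (Fin d)) :
    IntermediateField ℚ ℝ :=
  IntermediateField.adjoin ℚ {x : ℝ | ∃ γ i, x = L γ i}

/-- The coordinate `L γ i` as an element of `coordField L`. -/
noncomputable def coordOf {d : ℕ} (L : Γ →+ EuclideanSpace ℝ (Fin d)) (γ : Γ) (i : Fin d) :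
    coordField L :=
  ⟨L γ i, IntermediateField.subset_adjoin _ _ ⟨γ, i, rfl⟩⟩

variable {d : ℕ} {L : Γ →+ EuclideanSpace ℝ (Fin d)} {p : V → EuclideanSpace ℝ (Fin d)}

theorem exists_generic [Finite V] [Countable Γ] (L : Γ →+ EuclideanSpace ℝ (Fin d)) :
    ∃ p : V → EuclideanSpace ℝ (Fin d), Generic L p := by
  have hS : {x : ℝ | ∃ γ i, x = L γ i}.Countable := by
    refine (Set.countable_range fun γi : Γ × Fin d => L γi.1 γi.2).mono ?_
    rintro _ ⟨γ, i, rfl⟩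
    exact ⟨(γ, i), rfl⟩
  have hK : Countable (coordField L) := by
    rw [← Cardinal.mk_le_aleph0_iff]
    refine (IntermediateField.cardinalMk_adjoin_le ℚ _).trans ?_
    simp [hS.le_aleph0]
  obtain ⟨s, hs⟩ := exists_isTranscendenceBasis (coordField L) ℝ
  have : Infinite s := Set.infinite_coe_iff.2 fun hfin =>
    not_countable_of_isTranscendenceBasis hs hfin.countable
  obtain ⟨n, ⟨f⟩⟩ := Finite.exists_equiv_fin (V × Fin d)
  let g : V × Fin d ↪ s := f.toEmbedding.trans (Fin.valEmbedding.trans (Infinite.natEmbedding s))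
  exact ⟨fun v => WithLp.toLp 2 fun i => g (v, i), hs.1.comp g g.injective⟩

theorem Generic.aeval_ne_zero (hp : Generic L p)
    {P : MvPolynomial (V × Fin d) (coordField L)} {q : V → EuclideanSpace ℝ (Fin d)}
    (hq : MvPolynomial.aeval (fun vi : V × Fin d => q vi.1 vi.2) P ≠ 0) :
    MvPolynomial.aeval (fun vi : V × Fin d => p vi.1 vi.2) P ≠ 0 := by
  intro h
  rw [show P = 0 from hp (h.trans (map_zero _).symm), map_zero] at hq
  exact hq rfl

theorem Generic.sub_ne [NeZero d] (hp : Generic L p) {u v : V} (huv : u ≠ v) (γ : Γ) :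
    p u - p v ≠ L γ := by
  classical
  have := hp.aeval_ne_zero (P := .X (u, 0) - .X (v, 0) - .C (coordOf L γ 0))
    (q := Pi.single u (EuclideanSpace.single 0 (L γ 0 + 1)))
    (by simp [huv.symm, IntermediateField.algebraMap_apply, coordOf])
  intro h
  apply this
  simp [← h, IntermediateField.algebraMap_apply, coordOf]

theorem Generic.det_ne_zero {L : Γ →+ EuclideanSpace ℝ (Fin 2)} {p : V → EuclideanSpace ℝ (Fin 2)}
    (hp : Generic L p) {u v : V} (huv : u ≠ v) {γ : Γ} (hγ : L γ ≠ 0) :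
    (p u 0 - p v 0) * L γ 1 - (p u 1 - p v 1) * L γ 0 ≠ 0 := by
  classical
  have key := fun q => hp.aeval_ne_zero (q := q)
    (P := (.X (u, 0) - .X (v, 0)) * .C (coordOf L γ 1) -
      (.X (u, 1) - .X (v, 1)) * .C (coordOf L γ 0))
  simp only [map_sub, map_mul, MvPolynomial.aeval_X, MvPolynomial.algHom_C,
    IntermediateField.algebraMap_apply, coordOf] at key
  obtain ⟨i, hi⟩ : ∃ i, L γ i ≠ 0 := by
    by_contra! h
    exact hγ (PiLp.ext h)
  fin_cases i
  · exact key (Pi.single u (EuclideanSpace.single 1 1)) (by simpa [huv.symm] using hi)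
  · exact key (Pi.single u (EuclideanSpace.single 0 1)) (by simpa [huv.symm] using hi)

theorem Generic.eq_zero_of_inner_eq_zero {L : Γ →+ EuclideanSpace ℝ (Fin 2)}
    {p : V → EuclideanSpace ℝ (Fin 2)} (hp : Generic L p) {u v : V} (huv : u ≠ v) {γ : Γ}
    (hγ : L γ ≠ 0) {x : EuclideanSpace ℝ (Fin 2)} (hx : inner ℝ (p u - p v) x = 0)
    (hx' : inner ℝ (L γ) x = 0) : x = 0 := by
  simp only [PiLp.inner_apply, Fin.sum_univ_two, PiLp.sub_apply, RCLike.inner_apply, conj_trivial]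
    at hx hx'
  have h0 : x 0 = 0 := (mul_eq_zero.1 (by linear_combination L γ 1 * hx - (p u 1 - p v 1) * hx')
    ).resolve_left (hp.det_ne_zero huv hγ)
  have h1 : x 1 = 0 := (mul_eq_zero.1 (by linear_combination (p u 0 - p v 0) * hx' - L γ 0 * hx)
    ).resolve_left (hp.det_ne_zero huv hγ)
  ext i
  fin_cases i <;> assumption

end Generic

section RowVector

variable {d : ℕ} [DecidableEq V]

/-- The row of the rigidity matrix at the edge `e` as a vector of coordinates; coordinates are
needed to see that the Gram determinants of rows are polynomials in the coordinates of `p`. -/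
noncomputable def rowVector (G : LabeledGraph V E Γ) (L : Γ →+ EuclideanSpace ℝ (Fin d))
    (p : V → EuclideanSpace ℝ (Fin d)) (e : E) : EuclideanSpace ℝ (V × Fin d) :=
  WithLp.toLp 2 fun vi => G.edgeVec L p e vi.2 *
    ((if vi.1 = G.src e then 1 else 0) - (if vi.1 = G.tgt e then 1 else 0))

variable {G : LabeledGraph V E Γ} {L : Γ →+ EuclideanSpace ℝ (Fin d)}
  {p q : V → EuclideanSpace ℝ (Fin d)} {F : Set E}

theorem row_single (e : E) (v : V) (i : Fin d) :
    G.row L p e (Pi.single v (EuclideanSpace.single i 1)) = G.rowVector L p e (v, i) := by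
  have h : ∀ w, (Pi.single v (EuclideanSpace.single i 1) : V → EuclideanSpace ℝ (Fin d)) w =
      (if v = w then 1 else 0 : ℝ) • EuclideanSpace.single i 1 := fun w => by
    rcases eq_or_ne v w with rfl | hvw <;> simp [*]
  rw [row_apply, h, h, ← sub_smul, inner_smul_right, EuclideanSpace.inner_single_right, rowVector]
  simp [mul_comm]

theorem linearIndepOn_row_iff_rowVector [Finite V] :
    LinearIndepOn ℝ (G.row L p) F ↔ LinearIndepOn ℝ (G.rowVector L p) F := by
  let T : Module.Dual ℝ (V → EuclideanSpace ℝ (Fin d)) →ₗ[ℝ] EuclideanSpace ℝ (V × Fin d) :=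
    (WithLp.linearEquiv 2 ℝ (V × Fin d → ℝ)).symm.toLinearMap ∘ₗ
      LinearMap.pi fun vi => LinearMap.applyₗ (Pi.single vi.1 (EuclideanSpace.single vi.2 (1 : ℝ)))
  have hT : LinearMap.ker T = ⊥ := by
    refine LinearMap.ker_eq_bot'.2 fun φ hφ => LinearMap.pi_ext' fun v =>
      (EuclideanSpace.basisFun (Fin d) ℝ).toBasis.ext fun i => ?_
    simpa [T] using congrArg (fun x => x (v, i)) hφ
  have hrow : G.rowVector L p = T ∘ G.row L p := by
    ext e ⟨v, i⟩
    exact (row_single e v i).symm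
  rw [hrow]
  exact (T.linearIndependent_iff hT).symm

omit [DecidableEq V] in
theorem Generic.linearIndepOn_row [Finite V] [Finite E] (hp : Generic L p)
    (hq : LinearIndepOn ℝ (G.row L q) F) : LinearIndepOn ℝ (G.row L p) F := by
  classical
  have := Fintype.ofFinite V
  have := Fintype.ofFinite F
  let R (e : E) (vi : V × Fin d) : MvPolynomial (V × Fin d) (coordField L) :=
    (.X (G.src e, vi.2) - (.X (G.tgt e, vi.2) + .C (coordOf L (G.label e) vi.2))) *
      ((if vi.1 = G.src e then 1 else 0) - (if vi.1 = G.tgt e then 1 else 0))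
  let A : Matrix F F (MvPolynomial (V × Fin d) (coordField L)) :=
    Matrix.of fun e f => ∑ vi, R f vi * R e vi
  have hR (x : V → EuclideanSpace ℝ (Fin d)) (e : E) (vi : V × Fin d) :
      MvPolynomial.aeval (fun vi : V × Fin d => x vi.1 vi.2) (R e vi) = G.rowVector L x e vi := by
    simp [R, rowVector, edgeVec, coordOf, apply_ite (MvPolynomial.aeval _),
      IntermediateField.algebraMap_apply]
  have hA (x : V → EuclideanSpace ℝ (Fin d)) :
      MvPolynomial.aeval (fun vi : V × Fin d => x vi.1 vi.2) A.det =
        (Matrix.gram ℝ fun e : F => G.rowVector L x e).det := by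
    rw [AlgHom.map_det, AlgHom.mapMatrix_apply]
    congr 1
    ext e f
    simp only [A, Matrix.map_apply, Matrix.of_apply,
      map_sum, map_mul, hR, Matrix.gram, PiLp.inner_apply, RCLike.inner_apply, conj_trivial]
  rw [linearIndepOn_row_iff_rowVector, LinearIndepOn,
    ← Matrix.det_gram_ne_zero_iff_linearIndependent, ← hA] at hq ⊢
  exact hp.aeval_ne_zero hq

omit [DecidableEq V] in
theorem eventually_linearIndepOn_row [Finite V] [Finite E]
    (hp : LinearIndepOn ℝ (G.row L p) F) : ∀ᶠ q in 𝓝 p, LinearIndepOn ℝ (G.row L q) F := by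
  classical
  have := Fintype.ofFinite V
  simp only [linearIndepOn_row_iff_rowVector] at hp ⊢
  have hcont : Continuous fun q => fun e : F => G.rowVector L q e := by
    refine continuous_pi fun e => (PiLp.continuous_toLp 2 _).comp (continuous_pi fun vi => ?_)
    simp only [edgeVec]
    fun_prop
  exact hcont.continuousAt.eventually (LinearIndependent.eventually hp)

end RowVector

section TrivialMotions

/-- The velocity assignments that agree on `X` with a member of the family `ψ`. -/
def agreeOn {W S : Type*} [AddCommGroup W] [Module ℝ W] [AddCommGroup S] [Module ℝ S]
    (ψ : S →ₗ[ℝ] V → W) (X : Set V) : Submodule ℝ (V → W) :=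
  (LinearMap.range (LinearMap.funLeft ℝ W ((↑) : X → V) ∘ₗ ψ)).comap (LinearMap.funLeft ℝ W (↑))

/-- The infinitesimal translations. -/
def translation (V W : Type*) [AddCommGroup W] [Module ℝ W] : W →ₗ[ℝ] (V → W) :=
  LinearMap.pi fun _ => LinearMap.id

/-- The rotation of the plane by a right angle. -/
noncomputable def quarterTurn : EuclideanSpace ℝ (Fin 2) →ₗ[ℝ] EuclideanSpace ℝ (Fin 2) where
  toFun x := !₂[-x 1, x 0]
  map_add' x y := by ext i; fin_cases i <;> simp [add_comm]
  map_smul' c x := by ext i; fin_cases i <;> simp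

/-- The infinitesimal translations and rotations of the finite framework that is obtained from
`(G, L, p)` by moving each vertex `v` to `p v - L (φ v)`; if `φ` is a potential on a balanced edge
set, the edges of this set become ordinary edges. -/
noncomputable def euclidean (L : Γ →+ EuclideanSpace ℝ (Fin 2))
    (p : V → EuclideanSpace ℝ (Fin 2)) (φ : V → Γ) :
    (EuclideanSpace ℝ (Fin 2) × ℝ) →ₗ[ℝ] (V → EuclideanSpace ℝ (Fin 2)) :=
  LinearMap.pi fun v => LinearMap.fst ℝ _ ℝ +
    (LinearMap.snd ℝ (EuclideanSpace ℝ (Fin 2)) ℝ).smulRight (quarterTurn (p v - L (φ v)))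

section Module

variable {W S : Type*} [AddCommGroup W] [Module ℝ W] [AddCommGroup S] [Module ℝ S]

theorem mem_agreeOn {ψ : S →ₗ[ℝ] V → W} {X : Set V} {m : V → W} :
    m ∈ agreeOn ψ X ↔ ∃ s, ∀ v ∈ X, m v = ψ s v := by
  simp only [agreeOn, Submodule.mem_comap, LinearMap.mem_range]
  exact exists_congr fun s => ⟨fun h v hv => (congrFun h ⟨v, hv⟩).symm,
    fun h => funext fun v => (h v v.2).symm⟩

@[simp]
theorem translation_apply (t : W) (v : V) : translation V W t v = t := rfl

theorem finrank_agreeOn [Finite V] [FiniteDimensional ℝ W] [FiniteDimensional ℝ S]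
    {ψ : S →ₗ[ℝ] V → W} {X : Set V} (hψ : ∀ s, (∀ v ∈ X, ψ s v = 0) → s = 0) :
    Module.finrank ℝ (agreeOn ψ X) + X.ncard * Module.finrank ℝ W =
      Nat.card V * Module.finrank ℝ W + Module.finrank ℝ S := by
  set ρ : (V → W) →ₗ[ℝ] (X → W) := LinearMap.funLeft ℝ W (↑)
  have hinj : Function.Injective (ρ ∘ₗ ψ) := (injective_iff_map_eq_zero _).2 fun s hs =>
    hψ s fun v hv => congrFun hs ⟨v, hv⟩
  have hker : LinearMap.ker ((LinearMap.range (ρ ∘ₗ ψ)).mkQ ∘ₗ ρ) = agreeOn ψ X := by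
    rw [LinearMap.ker_comp, Submodule.ker_mkQ, agreeOn]
  have hrange : LinearMap.range ((LinearMap.range (ρ ∘ₗ ψ)).mkQ ∘ₗ ρ) = ⊤ :=
    LinearMap.range_eq_top.2 ((Submodule.mkQ_surjective _).comp
      (LinearMap.funLeft_surjective_of_injective ℝ W _ Subtype.val_injective))
  have h := LinearMap.finrank_range_add_finrank_ker ((LinearMap.range (ρ ∘ₗ ψ)).mkQ ∘ₗ ρ)
  have h' := (LinearMap.range (ρ ∘ₗ ψ)).finrank_quotient_add_finrank
  rw [hker, hrange, finrank_top] at h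
  rw [LinearMap.finrank_range_of_inj hinj] at h'
  rw [finrank_pi_const, Nat.card_coe_set_eq] at h'
  rw [finrank_pi_const] at h
  omega

theorem finrank_agreeOn_translation [Finite V] [FiniteDimensional ℝ W] {X : Set V}
    (hX : X.Nonempty) :
    Module.finrank ℝ (agreeOn (translation V W) X) + X.ncard * Module.finrank ℝ W =
      Nat.card V * Module.finrank ℝ W + Module.finrank ℝ W :=
  finrank_agreeOn fun _ h => h hX.some hX.some_mem

end Module

theorem agreeOn_translation_le_motions {W : Type*} [NormedAddCommGroup W] [InnerProductSpace ℝ W]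
    (G : LabeledGraph V E Γ) (L : Γ →+ W) (p : V → W) (F : Set E) :
    agreeOn (translation V W) (G.vertexSet F) ≤ G.motions L p F := by
  intro m hm
  obtain ⟨t, ht⟩ := mem_agreeOn.1 hm
  refine mem_motions.2 fun e he => ?_
  rw [row_apply, ht _ (G.src_mem_vertexSet he), ht _ (G.tgt_mem_vertexSet he), translation_apply,
    translation_apply, sub_self, inner_zero_right]

theorem IsPotential.edgeVec_eq {W : Type*} [AddCommGroup W] {G : LabeledGraph V E Γ} {F : Set E}
    {φ : V → Γ} (h : G.IsPotential F φ) (L : Γ →+ W) (p : V → W) {e : E} (he : e ∈ F) :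
    G.edgeVec L p e = (p (G.src e) - L (φ (G.src e))) - (p (G.tgt e) - L (φ (G.tgt e))) := by
  rw [edgeVec, h e he, map_sub]
  abel

theorem inner_quarterTurn (x y : EuclideanSpace ℝ (Fin 2)) :
    inner ℝ x (quarterTurn y) = x 1 * y 0 - x 0 * y 1 := by
  simp only [quarterTurn, LinearMap.coe_mk, AddHom.coe_mk, PiLp.inner_apply, RCLike.inner_apply,
    conj_trivial, Fin.sum_univ_two, Matrix.cons_val_zero, Matrix.cons_val_one]
  ring

theorem inner_quarterTurn_self (x : EuclideanSpace ℝ (Fin 2)) : inner ℝ x (quarterTurn x) = 0 := by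
  rw [inner_quarterTurn, mul_comm, sub_self]

theorem quarterTurn_eq_zero {x : EuclideanSpace ℝ (Fin 2)} : quarterTurn x = 0 ↔ x = 0 := by
  simp [quarterTurn, PiLp.ext_iff, Fin.forall_fin_two, and_comm]

section Euclidean

variable {G : LabeledGraph V E Γ} {L : Γ →+ EuclideanSpace ℝ (Fin 2)}
  {p : V → EuclideanSpace ℝ (Fin 2)} {φ : V → Γ}

theorem euclidean_apply (s : EuclideanSpace ℝ (Fin 2) × ℝ) (v : V) :
    euclidean L p φ s v = s.1 + s.2 • quarterTurn (p v - L (φ v)) := rfl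

theorem euclidean_sub (s : EuclideanSpace ℝ (Fin 2) × ℝ) (u v : V) :
    euclidean L p φ s u - euclidean L p φ s v =
      s.2 • quarterTurn ((p u - L (φ u)) - (p v - L (φ v))) := by
  rw [euclidean_apply, euclidean_apply, add_sub_add_left_eq_sub, ← smul_sub, ← map_sub]

theorem agreeOn_euclidean_le_motions {F : Set E} (hφ : G.IsPotential F φ) :
    agreeOn (euclidean L p φ) (G.vertexSet F) ≤ G.motions L p F := by
  intro m hm
  obtain ⟨s, hs⟩ := mem_agreeOn.1 hm
  refine mem_motions.2 fun e he => ?_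
  rw [row_apply, hs _ (G.src_mem_vertexSet he), hs _ (G.tgt_mem_vertexSet he), euclidean_sub,
    ← hφ.edgeVec_eq L p he, inner_smul_right, inner_quarterTurn_self, mul_zero]

theorem Generic.smul_quarterTurn_sub_eq_zero (hp : Generic L p) {u v : V} (huv : u ≠ v) {ω : ℝ} :
    ω • quarterTurn ((p u - L (φ u)) - (p v - L (φ v))) = 0 ↔ ω = 0 := by
  have h : (p u - L (φ u)) - (p v - L (φ v)) = p u - p v - L (φ u - φ v) := by
    rw [map_sub]; abel
  rw [smul_eq_zero, quarterTurn_eq_zero, h, sub_eq_zero, or_iff_left (hp.sub_ne huv _)]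

theorem Generic.eq_zero_of_euclidean_eq_zero (hp : Generic L p) {u v : V} (huv : u ≠ v)
    {s : EuclideanSpace ℝ (Fin 2) × ℝ} (hu : euclidean L p φ s u = 0)
    (hv : euclidean L p φ s v = 0) : s = 0 := by
  have hω : s.2 = 0 := (hp.smul_quarterTurn_sub_eq_zero huv).1 <| by
    rw [← euclidean_sub, hu, hv, sub_zero]
  have ht : s.1 = 0 := by simpa [euclidean_apply, hω] using hu
  exact Prod.ext ht hω

theorem finrank_agreeOn_euclidean [Finite V] (hp : Generic L p) (φ : V → Γ) {X : Set V}
    (hX : X.Nontrivial) :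
    Module.finrank ℝ (agreeOn (euclidean L p φ) X) + X.ncard * 2 = Nat.card V * 2 + 3 := by
  obtain ⟨u, hu, v, hv, huv⟩ := hX
  simpa using finrank_agreeOn (ψ := euclidean L p φ) (X := X) fun s hs =>
    hp.eq_zero_of_euclidean_eq_zero huv (hs u hu) (hs v hv)

end Euclidean

theorem vertexSet_nontrivial {G : LabeledGraph V E Γ} {F : Set E} (hF : F.Nonempty) :
    (G.vertexSet F).Nontrivial :=
  ⟨_, G.src_mem_vertexSet hF.some_mem, _, G.tgt_mem_vertexSet hF.some_mem, G.loopless hF.some⟩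

theorem Generic.countIndep_of_linearIndepOn_row [Finite V] [Finite E] {G : LabeledGraph V E Γ}
    {L : Γ →+ EuclideanSpace ℝ (Fin 2)} {p : V → EuclideanSpace ℝ (Fin 2)} (hp : Generic L p)
    {F : Set E} (hF : LinearIndepOn ℝ (G.row L p) F) : G.CountIndep F := by
  intro F' hF' hne
  have hrank := ncard_add_finrank_motions (hF.mono hF')
  rw [finrank_euclideanSpace_fin] at hrank
  have hV := vertexSet_nontrivial (G := G) hne
  constructor
  · have hle := Submodule.finrank_mono (agreeOn_translation_le_motions G L p F')
    have htriv := finrank_agreeOn_translation (W := EuclideanSpace ℝ (Fin 2)) hV.nonempty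
    rw [finrank_euclideanSpace_fin] at htriv
    omega
  · intro hb
    obtain ⟨φ, hφ⟩ := (G.balanced_iff_potential F').1 hb
    have hle := Submodule.finrank_mono (agreeOn_euclidean_le_motions (L := L) (p := p) hφ)
    have htriv := finrank_agreeOn_euclidean hp φ hV
    omega

end TrivialMotions

section Component

theorem HasWalk.map_eq_sub {A : Type*} [AddCommGroup A] {G : LabeledGraph V E Γ} {F : Set E}
    {D : Γ →+ A} {f : V → A} (hf : ∀ e ∈ F, D (G.label e) = f (G.src e) - f (G.tgt e)) {u w : V}
    {g : Γ} (h : G.HasWalk F u w g) : D g = f u - f w := by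
  induction h with
  | nil => simp
  | forward he _ ih => rw [map_add, hf _ he, ih, sub_add_sub_cancel]
  | backward he _ ih => rw [map_add, map_neg, hf _ he, ih, neg_sub, sub_add_sub_cancel]

/-- The setoid on the vertices whose classes are the connected components of the graph with edge
set `F`. -/
def walkSetoid (G : LabeledGraph V E Γ) (F : Set E) : Setoid V where
  r u v := ∃ g, G.HasWalk F u v g
  iseqv :=
    { refl := fun v => ⟨0, .nil v⟩
      symm := fun ⟨g, h⟩ => ⟨-g, h.symm⟩
      trans := fun ⟨g, h⟩ ⟨g', h'⟩ => ⟨g + g', h.trans h'⟩ }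

/-- The type of connected components of the graph with edge set `F`. -/
abbrev Component (G : LabeledGraph V E Γ) (F : Set E) : Type _ := Quotient (G.walkSetoid F)

/-- The connected component of the vertex `v` in the graph with edge set `F`. -/
abbrev component (G : LabeledGraph V E Γ) (F : Set E) (v : V) : G.Component F := Quotient.mk _ v

variable {G : LabeledGraph V E Γ} {S : Set E}

theorem vertexSet_component_subset (x : G.Component S) :
    G.vertexSet (S ∩ (G.component S ∘ G.src) ⁻¹' {x}) ⊆ G.component S ⁻¹' {x} := by
  rintro _ ⟨e, ⟨heS, rfl⟩, rfl | rfl⟩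
  · rfl
  · exact Quotient.sound (HasWalk.forward heS (.nil _) |>.symm |> Exists.intro _)

theorem sum_ncard_component_add_two [Finite E] [Fintype (G.Component S)] :
    ∑ x, ((S ∩ (G.component S ∘ G.src) ⁻¹' {x}).ncard + 2) =
      S.ncard + 2 * Nat.card (G.Component S) := by
  rw [Finset.sum_add_distrib, sum_ncard_inter_preimage_singleton, Finset.sum_const,
    Finset.card_univ, ← Nat.card_eq_fintype_card, smul_eq_mul, mul_comm]

variable [Finite V]

theorem CountIndep.ncard_component_add_two_le (hS : G.CountIndep S) (x : G.Component S) :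
    (S ∩ (G.component S ∘ G.src) ⁻¹' {x}).ncard + 2 ≤ 2 * (G.component S ⁻¹' {x}).ncard := by
  rcases (S ∩ (G.component S ∘ G.src) ⁻¹' {x}).eq_empty_or_nonempty with h | h
  · have : 0 < (G.component S ⁻¹' {x}).ncard := (Set.ncard_pos).2 ⟨x.out, x.out_eq⟩
    rw [h, Set.ncard_empty]
    omega
  · have hcount := (hS _ Set.inter_subset_left h).1
    have hle := Set.ncard_le_ncard (vertexSet_component_subset x)
    omega

theorem CountIndep.ncard_component_add_two_lt (hS : G.CountIndep S) (hb : G.Balanced S) {e : E}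
    (he : e ∈ S) :
    (S ∩ (G.component S ∘ G.src) ⁻¹' {G.component S (G.src e)}).ncard + 2 <
      2 * (G.component S ⁻¹' {G.component S (G.src e)}).ncard := by
  have hne : (S ∩ (G.component S ∘ G.src) ⁻¹' {G.component S (G.src e)}).Nonempty := ⟨e, he, rfl⟩
  have hcount := (hS _ Set.inter_subset_left hne).2 (hb.mono Set.inter_subset_left)
  have hle := Set.ncard_le_ncard (vertexSet_component_subset (G.component S (G.src e)))
  omega

theorem sum_two_mul_ncard_component [Fintype (G.Component S)] :
    ∑ x, 2 * (G.component S ⁻¹' {x}).ncard = 2 * Nat.card V := by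
  have h := sum_ncard_inter_preimage_singleton Set.univ (G.component S)
  simp only [Set.univ_inter, Set.ncard_univ] at h
  rw [← Finset.mul_sum, h]

variable [Finite E]

theorem CountIndep.ncard_add_two_mul_card_component_le (hS : G.CountIndep S) :
    S.ncard + 2 * Nat.card (G.Component S) ≤ 2 * Nat.card V := by
  have := Fintype.ofFinite (G.Component S)
  rw [← sum_ncard_component_add_two, ← sum_two_mul_ncard_component (G := G) (S := S)]
  exact Finset.sum_le_sum fun x _ => hS.ncard_component_add_two_le x

theorem CountIndep.ncard_add_two_mul_card_component_lt (hS : G.CountIndep S) (hb : G.Balanced S)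
    (hne : S.Nonempty) : S.ncard + 2 * Nat.card (G.Component S) < 2 * Nat.card V := by
  have := Fintype.ofFinite (G.Component S)
  rw [← sum_ncard_component_add_two, ← sum_two_mul_ncard_component (G := G) (S := S)]
  exact Finset.sum_lt_sum (fun x _ => hS.ncard_component_add_two_le x)
    ⟨_, Finset.mem_univ _, hS.ncard_component_add_two_lt hb hne.some_mem⟩

end Component

/-! ### The rigidity matrix represents the count matroid -/

section CountsSuffice

/-- The map `(q, t) ↦ q (src e) - q (tgt e) - t • L (label e)`. Its value at `(q, 1)` is the edge
vector of `e`; the extra scalar makes the edge vector linear in the framework. -/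
noncomputable def edgeMap (G : LabeledGraph V E Γ) (L : Γ →+ EuclideanSpace ℝ (Fin 2)) (e : E) :
    (V → EuclideanSpace ℝ (Fin 2)) × ℝ →ₗ[ℝ] EuclideanSpace ℝ (Fin 2) :=
  LinearMap.coprod
    ((LinearMap.proj (G.src e) : (V → EuclideanSpace ℝ (Fin 2)) →ₗ[ℝ] EuclideanSpace ℝ (Fin 2)) -
      LinearMap.proj (G.tgt e))
    (-LinearMap.toSpanSingleton ℝ _ (L (G.label e)))

/-- The `i`-th coordinate of `edgeMap`. -/
noncomputable def edgeCoord (G : LabeledGraph V E Γ) (L : Γ →+ EuclideanSpace ℝ (Fin 2))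
    (i : Fin 2) (e : E) : Module.Dual ℝ ((V → EuclideanSpace ℝ (Fin 2)) × ℝ) :=
  (EuclideanSpace.proj i).toLinearMap ∘ₗ G.edgeMap L e

variable {G : LabeledGraph V E Γ} {S : Set E} {L : Γ →+ EuclideanSpace ℝ (Fin 2)}

theorem edgeMap_apply (e : E) (x : (V → EuclideanSpace ℝ (Fin 2)) × ℝ) :
    G.edgeMap L e x = x.1 (G.src e) - x.1 (G.tgt e) - x.2 • L (G.label e) := by
  simp [edgeMap, sub_eq_add_neg]

theorem mem_dualCoannihilator_edgeCoord {x : (V → EuclideanSpace ℝ (Fin 2)) × ℝ} :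
    x ∈ (Submodule.span ℝ
      (G.edgeCoord L 0 '' S ∪ G.edgeCoord L 1 '' S)).dualCoannihilator ↔
      ∀ e ∈ S, x.2 • L (G.label e) = x.1 (G.src e) - x.1 (G.tgt e) := by
  rw [← SetLike.mem_coe, Submodule.coe_dualCoannihilator_span]
  have h (e : E) : x.2 • L (G.label e) = x.1 (G.src e) - x.1 (G.tgt e) ↔
      G.edgeCoord L 0 e x = 0 ∧ G.edgeCoord L 1 e x = 0 := by
    rw [eq_comm, ← sub_eq_zero, ← edgeMap_apply, PiLp.ext_iff, Fin.forall_fin_two]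
    rfl
  simp only [h, imp_and, forall_and]
  refine ⟨fun hx =>
    ⟨fun e he => hx _ (.inl ⟨e, he, rfl⟩), fun e he => hx _ (.inr ⟨e, he, rfl⟩)⟩, ?_⟩
  rintro ⟨h₀, h₁⟩ _ (⟨e, he, rfl⟩ | ⟨e, he, rfl⟩)
  exacts [h₀ e he, h₁ e he]

theorem HasWalk.smul_eq_sub {u w : V} {g : Γ} (hg : G.HasWalk S u w g)
    {x : (V → EuclideanSpace ℝ (Fin 2)) × ℝ}
    (hx : ∀ e ∈ S, x.2 • L (G.label e) = x.1 (G.src e) - x.1 (G.tgt e)) :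
    x.2 • L g = x.1 u - x.1 w :=
  hg.map_eq_sub (D := (DistribSMul.toAddMonoidHom _ x.2).comp L) hx

theorem eq_zero_of_forall_out_eq_zero {x : (V → EuclideanSpace ℝ (Fin 2)) × ℝ}
    (hx : ∀ e ∈ S, x.2 • L (G.label e) = x.1 (G.src e) - x.1 (G.tgt e)) (hx₂ : x.2 = 0)
    (hx₁ : ∀ c : G.Component S, x.1 c.out = 0) : x = 0 := by
  refine Prod.ext (funext fun v => ?_) hx₂
  obtain ⟨g, hg⟩ : ∃ g, G.HasWalk S v (G.component S v).out g :=
    Quotient.exact (G.component S v).out_eq.symm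
  have h := hg.smul_eq_sub hx
  rw [hx₂, zero_smul, hx₁, sub_zero] at h
  exact h.symm

theorem CountIndep.ncard_add_one_le_finrank_span_edgeCoord [Finite V] [Finite E]
    (hL : Function.Injective L) (hS : G.CountIndep S) (hne : S.Nonempty) :
    S.ncard + 1 ≤ Module.finrank ℝ
      (Submodule.span ℝ (G.edgeCoord L 0 '' S ∪ G.edgeCoord L 1 '' S)) := by
  set W := Submodule.span ℝ (G.edgeCoord L 0 '' S ∪ G.edgeCoord L 1 '' S)
  have hdim : Module.finrank ℝ W + Module.finrank ℝ W.dualCoannihilator = 2 * Nat.card V + 1 := by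
    rw [Subspace.finrank_add_finrank_dualCoannihilator_eq, Module.finrank_prod, finrank_pi_const,
      finrank_euclideanSpace_fin, Module.finrank_self, mul_comm]
  let atOut : W.dualCoannihilator →ₗ[ℝ] G.Component S → EuclideanSpace ℝ (Fin 2) :=
    LinearMap.funLeft ℝ _ Quotient.out ∘ₗ LinearMap.fst ℝ _ ℝ ∘ₗ W.dualCoannihilator.subtype
  let atOut' : W.dualCoannihilator →ₗ[ℝ] (G.Component S → EuclideanSpace ℝ (Fin 2)) × ℝ :=
    atOut.prod (LinearMap.snd ℝ _ ℝ ∘ₗ W.dualCoannihilator.subtype)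
  have hker (x : W.dualCoannihilator) (hx₂ : x.1.2 = 0) (hx₁ : atOut x = 0) : x = 0 :=
    Subtype.ext <| eq_zero_of_forall_out_eq_zero (mem_dualCoannihilator_edgeCoord.1 x.2) hx₂
      (congrFun hx₁)
  by_cases hb : G.Balanced S
  · have hinj : Function.Injective atOut' := (injective_iff_map_eq_zero _).2 fun x hx =>
      hker x (congrArg Prod.snd hx) (congrArg Prod.fst hx)
    have hle := LinearMap.finrank_le_finrank_of_injective hinj
    have hlt := hS.ncard_add_two_mul_card_component_lt hb hne
    rw [Module.finrank_prod, finrank_pi_const, finrank_euclideanSpace_fin, Module.finrank_self]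
      at hle
    omega
  · simp only [Balanced, not_forall] at hb
    obtain ⟨v, g, hg, hg0⟩ := hb
    have hinj : Function.Injective atOut := (injective_iff_map_eq_zero _).2 fun x hx =>
      hker x ((smul_eq_zero.1 ((hg.smul_eq_sub (mem_dualCoannihilator_edgeCoord.1 x.2)).trans
        (sub_self _))).resolve_right fun h => hg0 ((map_eq_zero_iff L hL).1 h)) hx
    have hle := LinearMap.finrank_le_finrank_of_injective hinj
    have hcard := hS.ncard_add_two_mul_card_component_le
    rw [finrank_pi_const, finrank_euclideanSpace_fin] at hle
    omega

theorem edgeMap_eq_smul_edgeVec {q : V → EuclideanSpace ℝ (Fin 2)} {t : ℝ} (ht : t ≠ 0) (e : E) :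
    G.edgeMap L e (q, t) = t • G.edgeVec L (t⁻¹ • q) e := by
  simp [edgeMap_apply, edgeVec, smul_sub, smul_smul, ht, sub_sub]

/-- The hyperplane of functionals vanishing at `(q, t)` meets the planes spanned by the coordinates
of the `edgeMap`s in the rows at the framework `t⁻¹ • q`, up to a change of coordinates. -/
theorem exists_kernelVec_edgeCoord_eq (G : LabeledGraph V E Γ) (L : Γ →+ EuclideanSpace ℝ (Fin 2))
    (q : V → EuclideanSpace ℝ (Fin 2)) {t : ℝ} (ht : t ≠ 0) :
    ∃ T : Module.Dual ℝ (V → EuclideanSpace ℝ (Fin 2)) →ₗ[ℝ]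
        Module.Dual ℝ ((V → EuclideanSpace ℝ (Fin 2)) × ℝ), ∀ e,
      kernelVec (Module.Dual.eval ℝ _ (q, t)) (G.edgeCoord L 0 e) (G.edgeCoord L 1 e) =
        T (G.row L (t⁻¹ • q) e) := by
  let turn : (V → EuclideanSpace ℝ (Fin 2)) × ℝ →ₗ[ℝ] (V → EuclideanSpace ℝ (Fin 2)) :=
    quarterTurn.compLeft V ∘ₗ LinearMap.coprod (t • LinearMap.id) (-LinearMap.toSpanSingleton ℝ _ q)
  refine ⟨turn.dualMap, fun e => LinearMap.ext fun y => ?_⟩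
  have hturn : turn y (G.src e) - turn y (G.tgt e) =
      t • quarterTurn (G.edgeMap L e y) - y.2 • quarterTurn (G.edgeMap L e (q, t)) := by
    simp only [turn, LinearMap.comp_apply, LinearMap.compLeft_apply, Function.comp_apply,
      LinearMap.coprod_apply, Pi.add_apply, edgeMap_apply, ← map_sub, ← map_smul]
    congr 1
    simp only [LinearMap.smul_apply, LinearMap.id_apply, Pi.smul_apply, LinearMap.neg_apply,
      LinearMap.toSpanSingleton_apply, Pi.neg_apply]
    module
  calc kernelVec (Module.Dual.eval ℝ _ (q, t)) (G.edgeCoord L 0 e) (G.edgeCoord L 1 e) y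
      = inner ℝ (G.edgeMap L e (q, t)) (quarterTurn (G.edgeMap L e y)) := by
        rw [inner_quarterTurn]
        rfl
    _ = inner ℝ (G.edgeVec L (t⁻¹ • q) e) (turn y (G.src e) - turn y (G.tgt e)) := by
        simp only [hturn, edgeMap_eq_smul_edgeVec ht, map_smul, inner_sub_right, inner_smul_left,
          inner_smul_right, inner_quarterTurn_self, conj_trivial, mul_zero, sub_zero]

theorem CountIndep.exists_linearIndepOn_row [Finite V] [Finite E] (hL : Function.Injective L)
    (hS : G.CountIndep S) : ∃ q, LinearIndepOn ℝ (G.row L q) S := by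
  have := Fintype.ofFinite E
  classical
  obtain ⟨h, hh⟩ := exists_linearIndepOn_kernelVec S.toFinset (G.edgeCoord L 0) (G.edgeCoord L 1)
    fun T hT hne => by
      rw [← Set.ncard_coe_finset]
      exact (countIndep_mono hS (Set.subset_toFinset.1 hT)).ncard_add_one_le_finrank_span_edgeCoord
        hL hne
  obtain ⟨h', hh', ht⟩ := exists_linearIndepOn_kernelVec_and_ne_zero S.toFinset.finite_toSet hh
    (y := LinearMap.snd ℝ (V → EuclideanSpace ℝ (Fin 2)) ℝ)
    fun h => one_ne_zero (congrArg (fun f => f (0, 1)) h)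
  obtain ⟨⟨q, t⟩, rfl⟩ := (Module.evalEquiv ℝ _).surjective h'
  rw [Set.coe_toFinset] at hh'
  obtain ⟨T, hT⟩ := exists_kernelVec_edgeCoord_eq G L q (t := t) ht
  refine ⟨t⁻¹ • q, LinearIndependent.of_comp T ?_⟩
  rwa [show T ∘ (fun e : S => G.row L (t⁻¹ • q) e) = _ from funext fun e => (hT e).symm]

theorem Generic.linearIndepOn_row_iff [Finite V] [Finite E] (hL : Function.Injective L)
    {p : V → EuclideanSpace ℝ (Fin 2)} (hp : Generic L p) :
    LinearIndepOn ℝ (G.row L p) S ↔ G.CountIndep S :=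
  ⟨hp.countIndep_of_linearIndepOn_row, fun h =>
    (h.exists_linearIndepOn_row hL).elim fun _ hq => hp.linearIndepOn_row hq⟩

end CountsSuffice

/-! ### Rigid edge sets -/

section RigidSet

/-- Every infinitesimal motion of the edge set `X` is trivial on `V(X)`: a translation if `X` is
unbalanced, and a Euclidean motion of the finite framework obtained from a potential if `X` is
balanced. -/
structure RigidSet (G : LabeledGraph V E Γ) (L : Γ →+ EuclideanSpace ℝ (Fin 2))
    (p : V → EuclideanSpace ℝ (Fin 2)) (X : Set E) : Prop where
  translation : ¬ G.Balanced X →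
    G.motions L p X ≤ agreeOn (translation V (EuclideanSpace ℝ (Fin 2))) (G.vertexSet X)
  euclidean : ∀ φ, G.IsPotential X φ →
    G.motions L p X ≤ agreeOn (euclidean L p φ) (G.vertexSet X)

variable {G : LabeledGraph V E Γ} {L : Γ →+ EuclideanSpace ℝ (Fin 2)}
  {p : V → EuclideanSpace ℝ (Fin 2)} {X Y : Set E} {e : E} {m : V → EuclideanSpace ℝ (Fin 2)}

theorem RigidSet.eq_of_src_eq_tgt (hX : G.RigidSet L p X) (hp : Generic L p)
    (hm : m ∈ G.motions L p X) (he : e ∈ X) (hme : m (G.src e) = m (G.tgt e)) {v : V}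
    (hv : v ∈ G.vertexSet X) : m v = m (G.src e) := by
  by_cases hb : G.Balanced X
  · obtain ⟨φ, hφ⟩ := (G.balanced_iff_potential X).1 hb
    obtain ⟨s, hs⟩ := mem_agreeOn.1 (hX.euclidean φ hφ hm)
    have hω : s.2 = 0 := (hp.smul_quarterTurn_sub_eq_zero (G.loopless e)).1 <| by
      rw [← euclidean_sub, ← hs _ (G.src_mem_vertexSet he), ← hs _ (G.tgt_mem_vertexSet he), hme,
        sub_self]
    simp [hs v hv, hs _ (G.src_mem_vertexSet he), euclidean_apply, hω]
  · obtain ⟨t, ht⟩ := mem_agreeOn.1 (hX.translation hb hm)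
    rw [ht v hv, ht _ (G.src_mem_vertexSet he)]
    rfl

theorem RigidSet.exists_eq_euclidean (hX : G.RigidSet L p X) (hY : G.RigidSet L p Y)
    (hp : Generic L p) (heX : e ∈ X) (heY : e ∈ Y) (hmX : m ∈ G.motions L p X)
    (hmY : m ∈ G.motions L p Y) {φ φ' : V → Γ} (hφ : G.IsPotential X φ)
    (hφ' : G.IsPotential Y φ') (hsrc : φ (G.src e) = φ' (G.src e)) :
    ∃ s, (∀ v ∈ G.vertexSet X, m v = LabeledGraph.euclidean L p φ s v) ∧
      ∀ v ∈ G.vertexSet Y, m v = LabeledGraph.euclidean L p φ' s v := by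
  obtain ⟨s, hs⟩ := mem_agreeOn.1 (hX.euclidean φ hφ hmX)
  obtain ⟨s', hs'⟩ := mem_agreeOn.1 (hY.euclidean φ' hφ' hmY)
  have htgt : φ (G.tgt e) = φ' (G.tgt e) := by
    have h := (hφ e heX).symm.trans (hφ' e heY)
    rwa [hsrc, sub_right_inj] at h
  have heq {v : V} (hvX : v ∈ G.vertexSet X) (hvY : v ∈ G.vertexSet Y) (hv : φ v = φ' v) :
      LabeledGraph.euclidean L p φ (s - s') v = 0 := by
    rw [map_sub, Pi.sub_apply, ← hs v hvX, hs' v hvY, euclidean_apply, euclidean_apply, hv,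
      sub_self]
  have hss : s = s' := sub_eq_zero.1 <| hp.eq_zero_of_euclidean_eq_zero (G.loopless e)
    (heq (G.src_mem_vertexSet heX) (G.src_mem_vertexSet heY) hsrc)
    (heq (G.tgt_mem_vertexSet heX) (G.tgt_mem_vertexSet heY) htgt)
  exact ⟨s, hs, hss ▸ hs'⟩

theorem RigidSet.balanced_of_src_ne_tgt (hX : G.RigidSet L p X) (hm : m ∈ G.motions L p X)
    (he : e ∈ X) (hme : m (G.src e) ≠ m (G.tgt e)) : G.Balanced X := by
  by_contra hb
  obtain ⟨t, ht⟩ := mem_agreeOn.1 (hX.translation hb hm)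
  exact hme ((ht _ (G.src_mem_vertexSet he)).trans (ht _ (G.tgt_mem_vertexSet he)).symm)

/-- A nontranslational motion rotates `X` and `Y` simultaneously, so it fixes the relative position
of their potentials at every common vertex. -/
theorem RigidSet.balanced_union_of_src_ne_tgt (hX : G.RigidSet L p X) (hY : G.RigidSet L p Y)
    (hL : Function.Injective L) (hp : Generic L p) (heX : e ∈ X) (heY : e ∈ Y)
    (hmX : m ∈ G.motions L p X) (hmY : m ∈ G.motions L p Y) (hme : m (G.src e) ≠ m (G.tgt e)) :
    G.Balanced (X ∪ Y) := by
  obtain ⟨φ, hφ⟩ := (G.balanced_iff_potential X).1 (hX.balanced_of_src_ne_tgt hmX heX hme)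
  obtain ⟨φ₀, hφ₀⟩ := (G.balanced_iff_potential Y).1 (hY.balanced_of_src_ne_tgt hmY heY hme)
  set φ' : V → Γ := fun v => φ₀ v + (φ (G.src e) - φ₀ (G.src e)) with hφ'_def
  have hφ' : G.IsPotential Y φ' := fun f hf => by
    rw [hφ₀ f hf, hφ'_def, add_sub_add_right_eq_sub]
  obtain ⟨s, hsX, hsY⟩ := hX.exists_eq_euclidean hY hp heX heY hmX hmY hφ hφ'
    (add_sub_cancel _ _).symm
  have hω : s.2 ≠ 0 := fun hω => hme <| by
    rw [hsX _ (G.src_mem_vertexSet heX), hsX _ (G.tgt_mem_vertexSet heX), ← sub_eq_zero,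
      euclidean_sub, hω, zero_smul]
  refine balanced_union hφ hφ' (c := 0) fun v hv => ?_
  have h : s.2 • quarterTurn (L (φ' v - φ v)) = 0 := by
    have h := (hsX v hv.1).symm.trans (hsY v hv.2)
    rw [euclidean_apply, euclidean_apply, add_right_inj, ← sub_eq_zero, ← smul_sub, ← map_sub,
      sub_sub_sub_cancel_left, ← map_sub] at h
    exact h
  rw [smul_eq_zero, or_iff_right hω, quarterTurn_eq_zero, map_eq_zero_iff L hL] at h
  rw [← neg_sub, h, neg_zero]

theorem RigidSet.union (hX : G.RigidSet L p X) (hY : G.RigidSet L p Y) (hL : Function.Injective L)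
    (hp : Generic L p) (heX : e ∈ X) (heY : e ∈ Y) : G.RigidSet L p (X ∪ Y) := by
  have hmX : G.motions L p (X ∪ Y) ≤ G.motions L p X := motions_anti Set.subset_union_left
  have hmY : G.motions L p (X ∪ Y) ≤ G.motions L p Y := motions_anti Set.subset_union_right
  constructor
  · intro hb m hm
    have hme : m (G.src e) = m (G.tgt e) := by
      by_contra hme
      exact hb (hX.balanced_union_of_src_ne_tgt hY hL hp heX heY (hmX hm) (hmY hm) hme)
    rw [vertexSet_union]
    exact mem_agreeOn.2 ⟨m (G.src e), fun v => Or.rec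
      (hX.eq_of_src_eq_tgt hp (hmX hm) heX hme) (hY.eq_of_src_eq_tgt hp (hmY hm) heY hme)⟩
  · intro φ hφ m hm
    obtain ⟨s, hsX, hsY⟩ := hX.exists_eq_euclidean hY hp heX heY (hmX hm) (hmY hm)
      (hφ.mono Set.subset_union_left) (hφ.mono Set.subset_union_right) rfl
    rw [vertexSet_union]
    exact mem_agreeOn.2 ⟨s, fun v => Or.rec (hsX v) (hsY v)⟩

end RigidSet

section Circuit

variable [Finite V] [Finite E] {G : LabeledGraph V E Γ}

theorem ncard_lt_of_isCircuit {C : Set E} (hC : G.countMatroid.IsCircuit C) :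
    2 * (G.vertexSet C).ncard < C.ncard + 2 ∨
      (G.Balanced C ∧ 2 * (G.vertexSet C).ncard < C.ncard + 3) := by
  have h : ¬ G.CountIndep C := hC.not_indep
  simp only [CountIndep, not_forall, not_and_or, not_le] at h
  obtain ⟨X, hXC, hne, hX⟩ := h
  have hXdep : ¬ G.countMatroid.Indep X := fun hI => hX.elim
    (fun h => (hI X subset_rfl hne).1.not_gt h)
    fun ⟨hb, h⟩ => ((hI X subset_rfl hne).2 hb).not_gt h
  rw [hC.eq_of_not_indep_subset hXdep hXC] at hX
  simpa only [exists_prop] using hX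

theorem nontrivial_of_isCircuit {C : Set E} (hC : G.countMatroid.IsCircuit C) : C.Nontrivial := by
  rw [← Set.one_lt_ncard_iff_nontrivial]
  have h₁ := ncard_lt_of_isCircuit hC
  have h₂ := Set.one_lt_ncard_iff_nontrivial.2 (G.vertexSet_nontrivial hC.nonempty)
  omega

variable {L : Γ →+ EuclideanSpace ℝ (Fin 2)} {p : V → EuclideanSpace ℝ (Fin 2)} {e : E}

theorem linearIndepOn_row_sdiff_singleton_of_isCircuit (hL : Function.Injective L)
    (hp : Generic L p) {C : Set E} (hC : G.countMatroid.IsCircuit C) (he : e ∈ C) :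
    LinearIndepOn ℝ (G.row L p) (C \ {e}) :=
  (hp.linearIndepOn_row_iff hL).2 (hC.sdiff_singleton_indep he)

theorem rigidSet_of_isCircuit (hL : Function.Injective L) (hp : Generic L p) {C : Set E}
    (hC : G.countMatroid.IsCircuit C) : G.RigidSet L p C := by
  obtain ⟨e, he⟩ := hC.nonempty
  have hrank := ncard_add_finrank_motions
    (linearIndepOn_row_sdiff_singleton_of_isCircuit hL hp hC he)
  rw [finrank_euclideanSpace_fin] at hrank
  have hmono := Submodule.finrank_mono (motions_anti (G := G) (L := L) (p := p)
    (Set.sdiff_subset (s := C) (t := {e})))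
  have hcard := Set.ncard_sdiff_singleton_add_one he
  have hlt := ncard_lt_of_isCircuit hC
  have hV := G.vertexSet_nontrivial hC.nonempty
  constructor
  · intro hb
    have hdim := finrank_agreeOn_translation (W := EuclideanSpace ℝ (Fin 2)) hV.nonempty
    rw [finrank_euclideanSpace_fin] at hdim
    have hlt := hlt.resolve_right fun h => hb h.1
    exact (Submodule.eq_of_le_of_finrank_le (G.agreeOn_translation_le_motions L p C)
      (by omega)).ge
  · intro φ hφ
    have hdim := finrank_agreeOn_euclidean hp φ hV
    exact (Submodule.eq_of_le_of_finrank_le (agreeOn_euclidean_le_motions hφ)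
      (by omega)).ge

theorem row_eq_zero_of_isCircuit (hL : Function.Injective L) (hp : Generic L p) {C : Set E}
    (hC : G.countMatroid.IsCircuit C) (he : e ∈ C) {m : V → EuclideanSpace ℝ (Fin 2)}
    (hm : m ∈ G.motions L p (C \ {e})) : G.row L p e m = 0 := by
  refine row_mem_span_iff.1 ?_ m hm
  rw [(linearIndepOn_row_sdiff_singleton_of_isCircuit hL hp hC he).mem_span_iff,
    Set.insert_sdiff_singleton, Set.insert_eq_of_mem he]
  exact fun h => absurd ((hp.linearIndepOn_row_iff hL).1 h) hC.not_indep

theorem rigidSet_sUnion_of_isCircuit (hL : Function.Injective L) (hp : Generic L p)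
    {𝒞 : Set (Set E)} (hne : 𝒞.Nonempty) (h𝒞 : ∀ C ∈ 𝒞, G.countMatroid.IsCircuit C ∧ e ∈ C) :
    G.RigidSet L p (⋃₀ 𝒞) := by
  induction 𝒞, Set.toFinite 𝒞 using Set.Finite.induction_on with
  | empty => exact absurd hne Set.not_nonempty_empty
  | @insert C 𝒟 _ _ ih =>
    have hC := h𝒞 C (Set.mem_insert C 𝒟)
    have hCr := rigidSet_of_isCircuit hL hp hC.1
    have h𝒟 : ∀ D ∈ 𝒟, _ := fun D hD => h𝒞 D (Set.mem_insert_of_mem C hD)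
    rw [Set.sUnion_insert]
    rcases 𝒟.eq_empty_or_nonempty with rfl | ⟨D, hD⟩
    · rwa [Set.sUnion_empty, Set.union_empty]
    · exact hCr.union (ih ⟨D, hD⟩ h𝒟) hL hp hC.2 ⟨D, hD, (h𝒟 D hD).2⟩

theorem rigidSet_circuitSetoid (hL : Function.Injective L) (hp : Generic L p)
    (he : ∃ C, G.countMatroid.IsCircuit C ∧ e ∈ C) :
    G.RigidSet L p {f | circuitSetoid G.countMatroid e f} := by
  have h := rigidSet_sUnion_of_isCircuit hL hp he fun _ hC => hC
  convert! h using 1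
  ext f
  constructor
  · rintro (rfl | ⟨C, hC, heC, hfC⟩)
    · exact Set.mem_sUnion.2 (he.imp fun C hC => ⟨hC, hC.2⟩)
    · exact ⟨C, ⟨hC, heC⟩, hfC⟩
  · rintro ⟨C, ⟨hC, heC⟩, hfC⟩
    exact .inr ⟨C, hC, heC, hfC⟩

omit [Finite V] [Finite E] in
theorem vertexSet_univ (hiso : ∀ v, ∃ e, G.src e = v ∨ G.tgt e = v) :
    G.vertexSet Set.univ = Set.univ :=
  Set.eq_univ_of_forall fun v => (hiso v).imp fun _ he => ⟨trivial, he⟩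

theorem MConnected.exists_isCircuit (hG : G.MConnected) (e : E) :
    ∃ C, G.countMatroid.IsCircuit C ∧ e ∈ C := by
  obtain ⟨f, -, hf⟩ := hG.1.exists_ne e
  rcases hG.2 e trivial f trivial with h | ⟨C, hC, he, -⟩
  · exact absurd h.symm hf
  · exact ⟨C, hC, he⟩

theorem MConnected.motions_compl_singleton_le (hG : G.MConnected)
    (hiso : ∀ v, ∃ e, G.src e = v ∨ G.tgt e = v) (hunb : ¬ G.Balanced Set.univ)
    (hL : Function.Injective L) (hp : Generic L p) (e : E) :
    G.motions L p {e}ᶜ ≤ agreeOn (translation V (EuclideanSpace ℝ (Fin 2))) Set.univ := by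
  obtain ⟨C, hC, heC⟩ := hG.exists_isCircuit e
  have h := rigidSet_circuitSetoid hL hp ⟨C, hC, heC⟩
  have huniv : {f | circuitSetoid G.countMatroid e f} = Set.univ :=
    Set.eq_univ_of_forall fun f => hG.2 e trivial f trivial
  have htriv := h.translation (by rwa [huniv])
  rw [huniv, vertexSet_univ hiso] at htriv
  refine fun m hm => htriv (mem_motions.2 fun f _ => ?_)
  rcases eq_or_ne f e with rfl | hf
  · exact row_eq_zero_of_isCircuit hL hp hC heC (motions_anti (fun g hg => hg.2) hm)
  · exact mem_motions.1 hm f hf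

end Circuit

/-! ### Edge cuts -/

section Cut

/-- The subgraph formed by the edges in `A` and their ends. -/
def edgeSubgraph (G : LabeledGraph V E Γ) (A : Set E) : G.Subgraph where
  verts := G.vertexSet A
  edges := A
  src_mem _ := G.src_mem_vertexSet
  tgt_mem _ := G.tgt_mem_vertexSet

/-- The edges with at least one end in `X`. -/
def incidentEdges (G : LabeledGraph V E Γ) (X : Set V) : Set E :=
  {e | G.src e ∈ X ∨ G.tgt e ∈ X}

variable {G : LabeledGraph V E Γ} {A : Set E} {u v : V}

theorem mem_vertexSet_of_adj (huv : G.toSimpleGraph.Adj u v)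
    (hu : u ∈ (G.edgeSubgraph A).inner) : v ∈ G.vertexSet A := by
  obtain ⟨e, he⟩ := huv
  have heA : e ∈ A := by
    by_contra heA
    exact hu.2 ⟨hu.1, e, heA, he.imp And.left And.right⟩
  exact ⟨e, heA, (he.imp And.right And.left).symm⟩

theorem mem_vertexSet_of_reachable_induce (hA : (G.edgeSubgraph A).boundary ⊆ {v})
    {x y : ({v}ᶜ : Set V)} (hxy : (G.toSimpleGraph.induce {v}ᶜ).Reachable x y)
    (hx : (x : V) ∈ G.vertexSet A) : (y : V) ∈ G.vertexSet A := by
  obtain ⟨w⟩ := hxy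
  induction w with
  | nil => exact hx
  | @cons x _ _ hadj _ ih => exact ih (mem_vertexSet_of_adj hadj ⟨hx, fun h => x.2 (hA h)⟩)

theorem TwoConnected.nontrivial_boundary (hG : G.TwoConnected) (hA : A.Nonempty)
    (hA' : Aᶜ.Nonempty) : (G.edgeSubgraph A).boundary.Nontrivial := by
  by_contra hnot
  obtain ⟨v, hv⟩ : ∃ v, (G.edgeSubgraph A).boundary ⊆ {v} := by
    have := hG.1.to_nonempty
    rcases (Set.not_nontrivial_iff.1 hnot).eq_empty_or_singleton with h | ⟨v, h⟩
    · exact ⟨Classical.arbitrary V, h ▸ Set.empty_subset _⟩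
    · exact ⟨v, h.subset⟩
  obtain ⟨x, hx, hxv⟩ := (G.vertexSet_nontrivial hA).exists_ne v
  obtain ⟨y, hy, hyv⟩ := (G.vertexSet_nontrivial hA').exists_ne v
  exact hyv (hv ⟨mem_vertexSet_of_reachable_induce hv
    ((hG.2.2 v).preconnected ⟨x, hxv⟩ ⟨y, hyv⟩) hx, hy⟩)

theorem vertexSet_incidentEdges_subset {X : Set V}
    (hX : ∀ x ∈ X, ∀ y, G.toSimpleGraph.Adj x y → y ∈ insert v X) :
    G.vertexSet (G.incidentEdges X) ⊆ insert v X := by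
  rintro _ ⟨e, he | he, rfl | rfl⟩
  · exact .inr he
  · exact hX _ he _ ⟨e, .inl ⟨rfl, rfl⟩⟩
  · exact hX _ he _ ⟨e, .inr ⟨rfl, rfl⟩⟩
  · exact .inr he

theorem boundary_incidentEdges_subset {X : Set V}
    (hX : ∀ x ∈ X, ∀ y, G.toSimpleGraph.Adj x y → y ∈ insert v X) :
    (G.edgeSubgraph (G.incidentEdges X)).boundary ⊆ {v} := by
  rintro z ⟨hz, e, he, hez⟩
  refine (vertexSet_incidentEdges_subset hX hz).resolve_right fun hzX => he ?_
  rcases hez with rfl | rfl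
  · exact .inl hzX
  · exact .inr hzX

theorem preconnected_induce_of_nontrivial_boundary
    (hiso : ∀ v, ∃ e, G.src e = v ∨ G.tgt e = v)
    (h : ∀ A : Set E, A.Nonempty → Aᶜ.Nonempty → (G.edgeSubgraph A).boundary.Nontrivial) (v : V) :
    (G.toSimpleGraph.induce {v}ᶜ).Preconnected := by
  intro x y
  by_contra hxy
  let X : Set V := Subtype.val '' {z | (G.toSimpleGraph.induce {v}ᶜ).Reachable x z}
  have hX : ∀ a ∈ X, ∀ b, G.toSimpleGraph.Adj a b → b ∈ insert v X := by
    rintro _ ⟨a, ha, rfl⟩ b hab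
    exact or_iff_not_imp_left.2 fun hb => ⟨⟨b, hb⟩, ha.trans (SimpleGraph.Adj.reachable hab), rfl⟩
  have hA : (G.incidentEdges X).Nonempty := by
    have hxX : (x : V) ∈ X := ⟨x, .refl _, rfl⟩
    obtain ⟨e, he | he⟩ := hiso x
    · exact ⟨e, .inl (he ▸ hxX)⟩
    · exact ⟨e, .inr (he ▸ hxX)⟩
  have hA' : (G.incidentEdges X)ᶜ.Nonempty := (hiso y).imp fun e he heX => by
    rcases vertexSet_incidentEdges_subset hX ⟨e, heX, he⟩ with hy | ⟨z, hz, hzy⟩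
    · exact y.2 hy
    · exact hxy (Subtype.ext hzy ▸ hz)
  exact (h _ hA hA').not_subset_singleton (boundary_incidentEdges_subset hX)

theorem twoConnected_of_nontrivial_boundary [Nontrivial V]
    (hiso : ∀ v, ∃ e, G.src e = v ∨ G.tgt e = v)
    (h : ∀ A : Set E, A.Nonempty → Aᶜ.Nonempty → (G.edgeSubgraph A).boundary.Nontrivial) :
    G.TwoConnected := by
  have hind := preconnected_induce_of_nontrivial_boundary hiso h
  refine ⟨‹_›, ⟨fun x y => ?_⟩, fun v => ?_⟩
  · rcases eq_or_ne y x with rfl | hyx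
    · rfl
    obtain ⟨x', hx'⟩ : ∃ x', G.toSimpleGraph.Adj x x' := by
      obtain ⟨e, he | he⟩ := hiso x
      · exact ⟨G.tgt e, e, .inl ⟨he, rfl⟩⟩
      · exact ⟨G.src e, e, .inr ⟨rfl, he⟩⟩
    exact hx'.reachable.trans
      ((hind x ⟨x', hx'.ne'⟩ ⟨y, hyx⟩).map (SimpleGraph.Embedding.induce _).toHom)
  · have : Nonempty ({v}ᶜ : Set V) := (exists_ne v).elim fun w hw => ⟨⟨w, hw⟩⟩
    exact ⟨hind v⟩

theorem MConnected.nontrivial_boundary [Finite V] [Finite E] (hG : G.MConnected)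
    (hA : A.Nonempty) (hA' : Aᶜ.Nonempty) : (G.edgeSubgraph A).boundary.Nontrivial := by
  obtain ⟨a, ha⟩ := hA
  obtain ⟨b, hb⟩ := hA'
  obtain ⟨C, hC, haC, hbC⟩ := (hG.2 a trivial b trivial).resolve_left fun h => hb (h ▸ ha)
  have hI : G.CountIndep (C ∩ A) := hC.ssubset_indep
    ((Set.ssubset_iff_of_subset Set.inter_subset_left).2 ⟨b, hbC, fun h => hb h.2⟩)
  have hI' : G.CountIndep (C \ A) := hC.ssubset_indep
    ((Set.ssubset_iff_of_subset Set.sdiff_subset).2 ⟨a, haC, fun h => h.2 ha⟩)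
  have hcount := hI _ subset_rfl ⟨a, haC, ha⟩
  have hcount' := hI' _ subset_rfl ⟨b, hbC, hb⟩
  have hE : (C ∩ A).ncard + (C \ A).ncard = C.ncard := Set.ncard_inter_add_ncard_sdiff_eq_ncard C A
  have hV := Set.ncard_union_add_ncard_inter (G.vertexSet (C ∩ A)) (G.vertexSet (C \ A))
  rw [← vertexSet_union, Set.inter_union_sdiff] at hV
  have hle : (G.vertexSet (C ∩ A) ∩ G.vertexSet (C \ A)).ncard ≤
      (G.edgeSubgraph A).boundary.ncard :=
    Set.ncard_le_ncard (Set.inter_subset_inter (G.vertexSet_mono Set.inter_subset_right)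
      (G.vertexSet_mono fun _ h => h.2))
  rw [← Set.one_lt_ncard_iff_nontrivial]
  rcases ncard_lt_of_isCircuit hC with h | ⟨hbal, h⟩
  · omega
  · have := hcount.2 (hbal.mono Set.inter_subset_left)
    have := hcount'.2 (hbal.mono Set.sdiff_subset)
    omega

end Cut

section MatroidComponent

theorem rank_eq_zero_of_balanced {G : LabeledGraph V E Γ} {F : Set E} (hF : G.Balanced F) :
    G.rank F = 0 := by
  have : G.gainGroup F = ⊥ := by
    rw [gainGroup, AddSubgroup.closure_eq_bot_iff]
    rintro g ⟨v, hv⟩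
    exact hF v g hv
  rw [rank, this]
  exact Module.finrank_zero_of_subsingleton

variable {G : LabeledGraph V E Γ}

theorem vertexSet_ne_pair_of_balanced {F : Set E} (h : G.Balanced F) {e f : E} (he : e ∈ F)
    (hf : f ∈ F) (hef : e ≠ f) : G.vertexSet F ≠ {G.src e, G.tgt e} := by
  intro hV
  obtain ⟨φ, hφ⟩ := (G.balanced_iff_potential F).1 h
  have hsrc : G.src f ∈ ({G.src e, G.tgt e} : Set V) := hV ▸ G.src_mem_vertexSet hf
  have htgt : G.tgt f ∈ ({G.src e, G.tgt e} : Set V) := hV ▸ G.tgt_mem_vertexSet hf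
  have hss := G.semisimple e f hef
  rcases hsrc with hsrc | hsrc <;> rcases htgt with htgt | htgt
  · exact G.loopless f (hsrc.trans htgt.symm)
  · exact hss.1 ⟨hsrc.symm, htgt.symm, by rw [hφ e he, hφ f hf, hsrc, htgt]⟩
  · exact hss.2 ⟨htgt.symm, hsrc.symm, by rw [hφ e he, hφ f hf, hsrc, htgt, neg_sub]⟩
  · exact G.loopless f (hsrc.trans htgt.symm)

theorem three_le_ncard_vertexSet_of_balanced [Finite V] {F : Set E} (h : G.Balanced F)
    (hF : F.Nontrivial) : 3 ≤ (G.vertexSet F).ncard := by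
  obtain ⟨e, he, f, hf, hef⟩ := hF
  by_contra! hlt
  refine vertexSet_ne_pair_of_balanced h he hf hef (Set.eq_of_subset_of_ncard_le ?_ ?_).symm
  · exact Set.pair_subset (G.src_mem_vertexSet he) (G.tgt_mem_vertexSet he)
  · rw [Set.ncard_pair (G.loopless e)]
    omega

theorem two_le_ncard_add_ncard_of_fiber {Q : Type*} [Finite Q] (f : E → Q) {v : V} {e : E}
    (he : G.src e = v ∨ G.tgt e = v) :
    2 ≤ {x | v ∈ G.vertexSet (f ⁻¹' {x})}.ncard +
      {x | v ∈ (G.edgeSubgraph (f ⁻¹' {x})).inner}.ncard := by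
  have hv : v ∈ G.vertexSet (f ⁻¹' {f e}) := ⟨e, rfl, he⟩
  by_cases hinner : v ∈ (G.edgeSubgraph (f ⁻¹' {f e})).inner
  · exact Nat.add_le_add ((Set.ncard_pos).2 ⟨f e, hv⟩) ((Set.ncard_pos).2 ⟨f e, hinner⟩)
  · obtain ⟨-, e', he', hve'⟩ : v ∈ (G.edgeSubgraph (f ⁻¹' {f e})).boundary := by
      by_contra hb
      exact hinner ⟨hv, hb⟩
    have hsub : {f e, f e'} ⊆ {x | v ∈ G.vertexSet (f ⁻¹' {x})} :=
      Set.pair_subset hv ⟨e', rfl, hve'⟩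
    have hle := Set.ncard_le_ncard hsub
    rw [Set.ncard_pair fun h => he' h.symm] at hle
    exact le_add_right hle

variable [Finite V] {L : Γ →+ EuclideanSpace ℝ (Fin 2)} {p : V → EuclideanSpace ℝ (Fin 2)}

theorem ncard_vertexSet_add_ncard_inner_add_ncard_boundary (A : Set E) :
    (G.vertexSet A).ncard + (G.edgeSubgraph A).inner.ncard + (G.edgeSubgraph A).boundary.ncard =
      2 * (G.vertexSet A).ncard := by
  have : (G.edgeSubgraph A).inner.ncard + (G.edgeSubgraph A).boundary.ncard =
      (G.vertexSet A).ncard := Set.ncard_sdiff_add_ncard_of_subset Set.inter_subset_left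
  omega

theorem two_mul_card_le_sum_ncard_add_ncard_inner {Q : Type*} [Fintype Q] (f : E → Q)
    (hiso : ∀ v, ∃ e, G.src e = v ∨ G.tgt e = v) :
    2 * Nat.card V ≤ ∑ x, ((G.vertexSet (f ⁻¹' {x})).ncard +
      (G.edgeSubgraph (f ⁻¹' {x})).inner.ncard) := by
  have := Fintype.ofFinite V
  rw [Finset.sum_add_distrib, sum_ncard_eq_sum_ncard_setOf_mem fun x => G.vertexSet (f ⁻¹' {x}),
    sum_ncard_eq_sum_ncard_setOf_mem fun x => (G.edgeSubgraph (f ⁻¹' {x})).inner,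
    ← Finset.sum_add_distrib, Nat.card_eq_fintype_card, mul_comm, ← smul_eq_mul,
    ← Finset.card_univ]
  refine Finset.card_nsmul_le_sum Finset.univ _ 2 fun v _ => ?_
  obtain ⟨e, he⟩ := hiso v
  exact two_le_ncard_add_ncard_of_fiber f he

theorem three_le_ncard_boundary_of_balanced (hblock : ¬ ∃ H : G.Subgraph, H.IsBlock 0 2)
    {D : Set E} (hb : G.Balanced D) (hD : D.Nontrivial)
    (hcut : (G.edgeSubgraph D).boundary.Nontrivial) : 3 ≤ (G.edgeSubgraph D).boundary.ncard := by
  by_contra! hlt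
  have htwo := Set.one_lt_ncard_iff_nontrivial.2 hcut
  refine hblock ⟨G.edgeSubgraph D, rank_eq_zero_of_balanced hb, by omega, ?_⟩
  have := three_le_ncard_vertexSet_of_balanced hb hD
  have := G.ncard_vertexSet_add_ncard_inner_add_ncard_boundary D
  exact (Set.ncard_pos (Set.toFinite _)).1 (by omega)

variable [Finite E]

theorem motions_inter_le_of_isBase (hL : Function.Injective L) (hp : Generic L p) {B D : Set E}
    (hB : G.countMatroid.IsBase B)
    (hD : ∀ C, G.countMatroid.IsCircuit C → (C ∩ D).Nonempty → C ⊆ D) :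
    G.motions L p (B ∩ D) ≤ G.motions L p D := by
  refine fun m hm => mem_motions.2 fun e he => ?_
  by_cases heB : e ∈ B
  · exact mem_motions.1 hm e ⟨heB, he⟩
  have hC := hB.fundCircuit_isCircuit trivial heB
  have heC := G.countMatroid.mem_fundCircuit e B
  have hsub : G.countMatroid.fundCircuit e B \ {e} ⊆ B ∩ D := fun f hf =>
    ⟨(G.countMatroid.fundCircuit_subset_insert e B hf.1).resolve_left hf.2,
      hD _ hC ⟨e, heC, he⟩ hf.1⟩
  exact row_eq_zero_of_isCircuit hL hp hC heC (motions_anti hsub hm)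

theorem RigidSet.two_mul_ncard_vertexSet_le {D : Set E} (hD : G.RigidSet L p D)
    (hL : Function.Injective L) (hp : Generic L p) (hne : D.Nonempty) {B : Set E}
    (hB : G.countMatroid.IsBase B)
    (hcl : ∀ C, G.countMatroid.IsCircuit C → (C ∩ D).Nonempty → C ⊆ D) :
    (G.Balanced D → 2 * (G.vertexSet D).ncard ≤ (B ∩ D).ncard + 3) ∧
      (¬ G.Balanced D → 2 * (G.vertexSet D).ncard ≤ (B ∩ D).ncard + 2) := by
  have hrank := ncard_add_finrank_motions ((hp.linearIndepOn_row_iff hL).2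
    (countIndep_mono hB.indep (Set.inter_subset_left (t := D))))
  rw [finrank_euclideanSpace_fin] at hrank
  have hmotions := motions_inter_le_of_isBase hL hp hB hcl
  have hV := G.vertexSet_nontrivial hne
  constructor <;> intro hb
  · obtain ⟨φ, hφ⟩ := (G.balanced_iff_potential D).1 hb
    have hle := Submodule.finrank_mono (hmotions.trans (hD.euclidean φ hφ))
    have hdim := finrank_agreeOn_euclidean hp φ hV
    omega
  · have hle := Submodule.finrank_mono (hmotions.trans (hD.translation hb))
    have hdim := finrank_agreeOn_translation (W := EuclideanSpace ℝ (Fin 2)) hV.nonempty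
    rw [finrank_euclideanSpace_fin] at hdim
    omega

/-- The rank of a matroid component pays for its vertices, where a vertex shared with other
components is counted once and any other vertex twice. -/
theorem RigidSet.ncard_vertexSet_add_ncard_inner_le {D : Set E} (hD : G.RigidSet L p D)
    (hL : Function.Injective L) (hp : Generic L p) {B : Set E}
    (hB : G.countMatroid.IsBase B)
    (hcl : ∀ C, G.countMatroid.IsCircuit C → (C ∩ D).Nonempty → C ⊆ D)
    (hblock : ¬ ∃ H : G.Subgraph, H.IsBlock 0 2) (hnt : D.Nontrivial)
    (hcut : (G.edgeSubgraph D).boundary.Nontrivial) :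
    (G.vertexSet D).ncard + (G.edgeSubgraph D).inner.ncard ≤ (B ∩ D).ncard := by
  have hcount := hD.two_mul_ncard_vertexSet_le hL hp hnt.nonempty hB hcl
  have hsum := G.ncard_vertexSet_add_ncard_inner_add_ncard_boundary D
  by_cases hb : G.Balanced D
  · have := hcount.1 hb
    have := three_le_ncard_boundary_of_balanced hblock hb hnt hcut
    omega
  · have := hcount.2 hb
    have := Set.one_lt_ncard_iff_nontrivial.2 hcut
    omega

theorem subset_circuitSetoid_of_inter_nonempty {C : Set E} (hC : G.countMatroid.IsCircuit C)
    {e : E} (h : (C ∩ {f | circuitSetoid G.countMatroid e f}).Nonempty) :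
    C ⊆ {f | circuitSetoid G.countMatroid e f} := by
  obtain ⟨g, hg, heg⟩ := h
  exact fun f hf => (circuitSetoid G.countMatroid).trans heg (.inr ⟨C, hC, hg, hf⟩)

theorem mConnected_of_forall_exists_isCircuit [Nontrivial V]
    (hiso : ∀ v, ∃ e, G.src e = v ∨ G.tgt e = v)
    (hblock : ¬ ∃ H : G.Subgraph, H.IsBlock 0 2)
    (hcut : ∀ A : Set E, A.Nonempty → Aᶜ.Nonempty → (G.edgeSubgraph A).boundary.Nontrivial)
    (hcirc : ∀ e, ∃ C, G.countMatroid.IsCircuit C ∧ e ∈ C) (hL : Function.Injective L)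
    (hp : Generic L p) : G.MConnected := by
  let s := circuitSetoid G.countMatroid
  refine ⟨?_, fun e₀ _ f₀ _ => ?_⟩
  · obtain ⟨v, -⟩ := exists_pair_ne V
    obtain ⟨e, -⟩ := hiso v
    obtain ⟨C, hC, -⟩ := hcirc e
    exact (nontrivial_of_isCircuit hC).mono C.subset_univ
  by_contra hnot
  have hcompl : ∀ e, {f | s e f}ᶜ.Nonempty := fun e => by
    by_contra! h
    rw [Set.compl_empty_iff, Set.eq_univ_iff_forall] at h
    exact hnot (s.trans (s.symm (h e₀)) (h f₀))
  obtain ⟨B, hB⟩ := G.countMatroid.exists_isBase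
  have := Fintype.ofFinite (Quotient s)
  have hle : ∀ x, (G.vertexSet (Quotient.mk s ⁻¹' {x})).ncard +
      (G.edgeSubgraph (Quotient.mk s ⁻¹' {x})).inner.ncard ≤
        (B ∩ Quotient.mk s ⁻¹' {x}).ncard := by
    refine Quotient.ind fun e => ?_
    have hfib : Quotient.mk s ⁻¹' {Quotient.mk s e} = {f | s e f} :=
      Set.ext fun f => Quotient.eq.trans s.comm'
    obtain ⟨C, hC, heC⟩ := hcirc e
    have hCe := subset_circuitSetoid_of_inter_nonempty hC ⟨e, heC, s.refl e⟩
    rw [hfib]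
    exact (rigidSet_circuitSetoid hL hp (hcirc e)).ncard_vertexSet_add_ncard_inner_le hL hp hB
      (fun C hC => subset_circuitSetoid_of_inter_nonempty hC) hblock
      ((nontrivial_of_isCircuit hC).mono hCe) (hcut _ ⟨e, s.refl e⟩ (hcompl e))
  have hVB : 2 * Nat.card V ≤ B.ncard := by
    rw [← sum_ncard_inter_preimage_singleton B (Quotient.mk s)]
    exact (two_mul_card_le_sum_ncard_add_ncard_inner _ hiso).trans
      (Finset.sum_le_sum fun x _ => hle x)
  have hVpos := Nat.card_pos (α := V)
  have hBne : B.Nonempty := (Set.ncard_pos (Set.toFinite _)).1 (by omega)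
  have hBV := (hB.indep B subset_rfl hBne).1
  have := Set.ncard_le_card (G.vertexSet B)
  omega

end MatroidComponent

section Coloop

variable [Finite V] [Finite E] {G : LabeledGraph V E Γ} {L : Γ →+ EuclideanSpace ℝ (Fin 2)}
  {p : V → EuclideanSpace ℝ (Fin 2)}

theorem exists_isCircuit_of_motions_compl_singleton_le (hL : Function.Injective L)
    (hp : Generic L p) {e : E}
    (h : G.motions L p {e}ᶜ ≤ agreeOn (translation V (EuclideanSpace ℝ (Fin 2))) Set.univ) :
    ∃ C, G.countMatroid.IsCircuit C ∧ e ∈ C := by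
  by_contra! hno
  have hcoloop : G.countMatroid.IsColoop e :=
    (Matroid.isColoop_iff_forall_notMem_isCircuit (by trivial)).2 hno
  have hmem : G.row L p e ∈ Submodule.span ℝ (G.row L p '' {e}ᶜ) :=
    row_mem_span_iff.2 fun m hm => by
      obtain ⟨t, ht⟩ := mem_agreeOn.1 (h hm)
      rw [row_apply, ht _ trivial, ht _ trivial, translation_apply, translation_apply, sub_self,
        inner_zero_right]
  obtain ⟨I, hIe, -, hspan, hI⟩ := exists_linearIndepOn_extension
    (linearIndepOn_empty ℝ (G.row L p)) (Set.empty_subset ({e}ᶜ : Set E))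
  have hins : LinearIndepOn ℝ (G.row L p) (insert e I) := by
    have hIind : G.countMatroid.Indep I := (hp.linearIndepOn_row_iff hL).1 hI
    obtain ⟨B, hB, hIB⟩ := hIind.exists_isBase_superset
    exact (hp.linearIndepOn_row_iff hL).2
      (hB.indep.subset (Set.insert_subset (hcoloop.mem_of_isBase hB) hIB))
  exact ((linearIndepOn_insert fun he => hIe he rfl).1 hins).2 (Submodule.span_le.2 hspan hmem)

end Coloop

/-! ### Local rigidity -/

section InfinitesimallyRigid

variable {W : Type*} [NormedAddCommGroup W] [InnerProductSpace ℝ W] {G : LabeledGraph V E Γ}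
  {L : Γ →+ W} {p : V → W}

theorem norm_edgeVec_add_sq (m : V → W) (e : E) :
    ‖G.edgeVec L (p + m) e‖ ^ 2 =
      ‖G.edgeVec L p e‖ ^ 2 + 2 * G.row L p e m + ‖m (G.src e) - m (G.tgt e)‖ ^ 2 := by
  have : G.edgeVec L (p + m) e = G.edgeVec L p e + (m (G.src e) - m (G.tgt e)) := by
    simp only [edgeVec, Pi.add_apply]
    abel
  rw [this, norm_add_sq_real, row_apply]

theorem abs_row_le_of_norm_edgeVec_add_sq_eq [Fintype V] {m : V → W} {e : E}
    (h : ‖G.edgeVec L (p + m) e‖ ^ 2 = ‖G.edgeVec L p e‖ ^ 2) :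
    |G.row L p e m| ≤ 2 * ‖m‖ ^ 2 := by
  have hnorm : ‖m (G.src e) - m (G.tgt e)‖ ≤ 2 * ‖m‖ := by
    have := norm_sub_le (m (G.src e)) (m (G.tgt e))
    have := norm_le_pi_norm m (G.src e)
    have := norm_le_pi_norm m (G.tgt e)
    linarith
  have hsq : ‖m (G.src e) - m (G.tgt e)‖ ^ 2 ≤ 4 * ‖m‖ ^ 2 := by
    calc _ ≤ (2 * ‖m‖) ^ 2 := by gcongr
      _ = _ := by ring
  have hrow : 2 * G.row L p e m = -‖m (G.src e) - m (G.tgt e)‖ ^ 2 := by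
    linarith [G.norm_edgeVec_add_sq (L := L) (p := p) m e]
  rw [abs_le]
  constructor <;> linarith [sq_nonneg ‖m (G.src e) - m (G.tgt e)‖, sq_nonneg ‖m‖]

variable [Finite V] [FiniteDimensional ℝ W]

/-- A small motion `m` with `m v₀ = 0` that preserves the edge lengths satisfies `R m = O(‖m‖²)`
for the rigidity matrix `R`, which is bounded below by a multiple of `‖m‖`. -/
theorem eventually_eq_zero_of_norm_edgeVec_add_sq_eq [Finite E]
    (h : G.motions L p Set.univ ≤ agreeOn (translation V W) Set.univ) (v₀ : V) :
    ∀ᶠ m in 𝓝 (0 : V → W), m v₀ = 0 →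
      (∀ e, ‖G.edgeVec L (p + m) e‖ ^ 2 = ‖G.edgeVec L p e‖ ^ 2) → m = 0 := by
  have := Fintype.ofFinite V
  have := Fintype.ofFinite E
  let R : (V → W) →ₗ[ℝ] (E → ℝ) × W :=
    (LinearMap.pi fun e => G.row L p e).prod (LinearMap.proj v₀)
  have hker : LinearMap.ker R = ⊥ := by
    refine LinearMap.ker_eq_bot'.2 fun m hm => ?_
    obtain ⟨t, ht⟩ := mem_agreeOn.1 <| h <| mem_motions.2 fun e _ =>
      congrFun (congrArg Prod.fst hm) e
    have ht₀ : m v₀ = t := ht v₀ trivial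
    have hm₀ : m v₀ = 0 := congrArg Prod.snd hm
    exact funext fun v => (ht v trivial).trans (ht₀.symm.trans hm₀)
  obtain ⟨K, -, hK⟩ := R.exists_antilipschitzWith hker
  have hcont : Continuous fun m : V → W => 2 * (K : ℝ) * ‖m‖ := by fun_prop
  have hsmall : ∀ᶠ m in 𝓝 (0 : V → W), 2 * (K : ℝ) * ‖m‖ < 1 :=
    hcont.continuousAt.eventually_lt_const (by simp)
  filter_upwards [hsmall] with m hm hm₀ hlen
  have hR : ‖R m‖ ≤ 2 * ‖m‖ ^ 2 := by
    refine max_le ((pi_norm_le_iff_of_nonneg (by positivity)).2 fun e => ?_) ?_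
    · exact abs_row_le_of_norm_edgeVec_add_sq_eq (hlen e)
    · exact (norm_eq_zero.2 hm₀).trans_le (by positivity)
  have hle : ‖m‖ ≤ (2 * K * ‖m‖) * ‖m‖ := by
    calc ‖m‖ ≤ K * ‖R m‖ := by simpa using hK.le_mul_dist m 0
      _ ≤ K * (2 * ‖m‖ ^ 2) := by gcongr
      _ = _ := by ring
  by_contra hne
  exact hle.not_gt (mul_lt_of_lt_one_left (norm_pos_iff.2 hne) hm)

theorem lPeriodicallyRigid_of_motions_le [Finite E] {d : ℕ} {L : Γ →+ EuclideanSpace ℝ (Fin d)}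
    {p : V → EuclideanSpace ℝ (Fin d)}
    (h : G.motions L p Set.univ ≤ agreeOn (translation V (EuclideanSpace ℝ (Fin d))) Set.univ) :
    G.LPeriodicallyRigid L p := by
  rcases isEmpty_or_nonempty V with hV | ⟨⟨v₀⟩⟩
  · exact Eventually.of_forall fun q _ u => hV.elim u
  let shift : (V → EuclideanSpace ℝ (Fin d)) → V → EuclideanSpace ℝ (Fin d) :=
    fun q v => q v - p v - (q v₀ - p v₀)
  have hshift : Tendsto shift (𝓝 p) (𝓝 0) := by
    have hcont : Continuous shift := by fun_prop
    have hp : shift p = 0 := funext fun v => by simp only [shift, sub_self, Pi.zero_apply]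
    exact hp ▸ hcont.tendsto p
  filter_upwards [hshift.eventually (eventually_eq_zero_of_norm_edgeVec_add_sq_eq h v₀)]
    with q hq hlen u v γ
  have hvec : ∀ u v a, (p + shift q) u - ((p + shift q) v + a) = q u - (q v + a) := by
    intro u v a
    simp only [shift, Pi.add_apply]
    abel
  have hzero : shift q = 0 :=
    hq (sub_self _) fun e => by rw [edgeVec, hvec]; exact (hlen e).symm
  rw [← hvec, hzero, add_zero]

end InfinitesimallyRigid

section RigidCurve

variable {W : Type*} [NormedAddCommGroup W] [InnerProductSpace ℝ W] {G : LabeledGraph V E Γ}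

theorem hasDerivAt_norm_sub_add_sq [Finite V] {c : ℝ → V → W} {w : V → W} {t : ℝ}
    (hc : HasDerivAt c w t) (u v : V) (a : W) :
    HasDerivAt (fun s => ‖c s u - (c s v + a)‖ ^ 2)
      (2 * inner ℝ (c t u - (c t v + a)) (w u - w v)) t := by
  have := Fintype.ofFinite V
  exact ((hasDerivAt_pi.1 hc u).sub ((hasDerivAt_pi.1 hc v).add_const a)).norm_sq

theorem hasFDerivAt_norm_edgeVec_sq [Finite V] [FiniteDimensional ℝ W] (G : LabeledGraph V E Γ)
    (L : Γ →+ W) (p : V → W) (e : E) :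
    HasFDerivAt (fun q => ‖G.edgeVec L q e‖ ^ 2)
      (2 • (G.row L p e).toContinuousLinearMap) p := by
  have := Fintype.ofFinite V
  exact ((hasFDerivAt_apply (𝕜 := ℝ) (G.src e) p).sub
    ((hasFDerivAt_apply (𝕜 := ℝ) (G.tgt e) p).add_const (L (G.label e)))).norm_sq

theorem exists_curve_of_linearIndepOn_row [Fintype V] [Finite E] [FiniteDimensional ℝ W]
    {L : Γ →+ W} {p w : V → W} {F : Set E} (hF : LinearIndepOn ℝ (G.row L p) F)
    (hw : w ∈ G.motions L p F) :
    ∃ c : ℝ → V → W, c 0 = p ∧ HasDerivAt c w 0 ∧ ContDiffAt ℝ 1 c 0 ∧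
      ∀ᶠ t in 𝓝 0, ∀ e ∈ F, ‖G.edgeVec L (c t) e‖ ^ 2 = ‖G.edgeVec L p e‖ ^ 2 := by
  have := Fintype.ofFinite F
  have hsq : ContDiff ℝ 1 fun q (e : F) => ‖G.edgeVec L q e‖ ^ 2 :=
    contDiff_pi.2 fun e => ContDiff.norm_sq ℝ (by unfold edgeVec; fun_prop)
  have hderiv : HasFDerivAt (fun q (e : F) => ‖G.edgeVec L q e‖ ^ 2)
      (2 • (LinearMap.pi fun e : F => G.row L p e).toContinuousLinearMap) p :=
    hasFDerivAt_pi'.2 fun e => G.hasFDerivAt_norm_edgeVec_sq L p e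
  have hsurj : LinearMap.range (2 • (LinearMap.pi fun e : F => G.row L p e)) = ⊤ := by
    rw [← Nat.cast_smul_eq_nsmul ℝ, LinearMap.range_smul _ _ (by norm_num),
      range_pi_eq_top_of_linearIndependent hF]
  have hker : 2 • (LinearMap.pi fun e : F => G.row L p e) w = 0 := by
    have hpi : (LinearMap.pi fun e : F => G.row L p e) w = 0 :=
      funext fun e => mem_motions.1 hw e e.2
    rw [hpi, smul_zero]
  obtain ⟨c, hc₀, hc', hc, hlen⟩ :=
    exists_curve_of_apply_eq_zero hsq.contDiffAt hderiv hsurj hker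
  exact ⟨c, hc₀, hc', hc, hlen.mono fun t ht e he => congrFun ht ⟨e, he⟩⟩

variable {d : ℕ} {L : Γ →+ EuclideanSpace ℝ (Fin d)} {p : V → EuclideanSpace ℝ (Fin d)}

theorem Generic.eventually_row_mem_span [Finite V] [Finite E] {F : Set E} (hp : Generic L p)
    (hF : LinearIndepOn ℝ (G.row L p) F)
    (hspan : ∀ e, G.row L p e ∈ Submodule.span ℝ (G.row L p '' F)) :
    ∀ᶠ q in 𝓝 p, ∀ e, G.row L q e ∈ Submodule.span ℝ (G.row L q '' F) := by
  filter_upwards [eventually_linearIndepOn_row hF] with q hq e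
  exact hq.mem_span_iff.2 fun h => hF.mem_span_iff.1 (hspan e) (hp.linearIndepOn_row h)

/-- At a generic framework, the rows of a maximal independent edge set keep spanning all rows
nearby, so a curve preserving the lengths of those edges preserves all edge lengths. -/
theorem Generic.exists_curve_of_mem_motions [Finite V] [Finite E] (hp : Generic L p)
    {w : V → EuclideanSpace ℝ (Fin d)} (hw : w ∈ G.motions L p Set.univ) :
    ∃ c : ℝ → V → EuclideanSpace ℝ (Fin d), c 0 = p ∧ HasDerivAt c w 0 ∧
      ∀ᶠ t in 𝓝 0, ∀ e, ‖G.edgeVec L (c t) e‖ ^ 2 = ‖G.edgeVec L p e‖ ^ 2 := by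
  have := Fintype.ofFinite V
  obtain ⟨F, -, -, hspan, hF⟩ := exists_linearIndepOn_extension
    (linearIndepOn_empty ℝ (G.row L p)) (Set.empty_subset Set.univ)
  obtain ⟨c, hc₀, hc', hc, hlen⟩ :=
    exists_curve_of_linearIndepOn_row hF (motions_anti (Set.subset_univ F) hw)
  have htend : Tendsto c (𝓝 0) (𝓝 p) := hc₀ ▸ hc'.continuousAt.tendsto
  have hdiff : ∀ᶠ t in 𝓝 0, DifferentiableAt ℝ c t :=
    (hc.eventually (by simp)).mono fun t ht => ht.differentiableAt one_ne_zero
  have hrows : ∀ᶠ t in 𝓝 0, ∀ e, G.row L (c t) e ∈ Submodule.span ℝ (G.row L (c t) '' F) :=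
    htend.eventually (hp.eventually_row_mem_span hF fun e => hspan ⟨e, trivial, rfl⟩)
  have hzero : ∀ᶠ t in 𝓝 0, ∀ e, HasDerivAt (fun s => ‖G.edgeVec L (c s) e‖ ^ 2) 0 t := by
    filter_upwards [hdiff, hrows, eventually_eventually_nhds.2 hlen] with t ht hrow hlen e
    have hd (f : E) : HasDerivAt (fun s => ‖G.edgeVec L (c s) f‖ ^ 2)
        (2 * G.row L (c t) f (deriv c t)) t := hasDerivAt_norm_sub_add_sq ht.hasDerivAt _ _ _
    have hmot : deriv c t ∈ G.motions L (c t) F := mem_motions.2 fun f hf => by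
      have hconst := (hasDerivAt_const t _).congr_of_eventuallyEq (hlen.mono fun s hs => hs f hf)
      simpa using (hd f).unique hconst
    simpa only [row_mem_span_iff.1 (hrow e) _ hmot, mul_zero] using hd e
  obtain ⟨ε, hε, hball⟩ := Metric.eventually_nhds_iff_ball.1 hzero
  refine ⟨c, hc₀, hc', ?_⟩
  filter_upwards [Metric.ball_mem_nhds (0 : ℝ) hε] with t ht e
  rw [← hc₀]
  exact Metric.isOpen_ball.is_const_of_deriv_eq_zero (convex_ball (0 : ℝ) ε).isPreconnected
    (f := fun s => ‖G.edgeVec L (c s) e‖ ^ 2)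
    (fun s hs => (hball s hs e).differentiableAt.differentiableWithinAt)
    (fun s hs => (hball s hs e).deriv) ht (Metric.mem_ball_self hε)

theorem Generic.inner_eq_zero_of_lPeriodicallyRigid [Finite V] [Finite E] (hp : Generic L p)
    (hG : G.LPeriodicallyRigid L p) {w : V → EuclideanSpace ℝ (Fin d)}
    (hw : w ∈ G.motions L p Set.univ) (u v : V) (γ : Γ) :
    inner ℝ (p u - (p v + L γ)) (w u - w v) = 0 := by
  have := Fintype.ofFinite V
  obtain ⟨c, hc₀, hc', hlen⟩ := hp.exists_curve_of_mem_motions hw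
  have htend : Tendsto c (𝓝 0) (𝓝 p) := hc₀ ▸ hc'.continuousAt.tendsto
  have hdist : ∀ᶠ t in 𝓝 0, ‖c t u - (c t v + L γ)‖ ^ 2 = ‖p u - (p v + L γ)‖ ^ 2 := by
    filter_upwards [hlen, htend.eventually hG] with t ht hrigid
    exact (hrigid (fun e => (ht e).symm) u v γ).symm
  have hderiv := (hasDerivAt_norm_sub_add_sq hc' u v (L γ)).unique
    ((hasDerivAt_const 0 _).congr_of_eventuallyEq hdist)
  simpa [hc₀] using hderiv

theorem Generic.motions_le_of_lPeriodicallyRigid [Finite V] [Finite E]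
    {L : Γ →+ EuclideanSpace ℝ (Fin 2)} {p : V → EuclideanSpace ℝ (Fin 2)} (hp : Generic L p)
    {γ : Γ} (hγ : L γ ≠ 0) (hG : G.LPeriodicallyRigid L p) :
    G.motions L p Set.univ ≤ agreeOn (translation V (EuclideanSpace ℝ (Fin 2))) Set.univ := by
  intro w hw
  have heq (u v : V) : w u = w v := by
    by_contra hne
    have huv : u ≠ v := ne_of_apply_ne w hne
    have h₀ : inner ℝ (p u - p v) (w u - w v) = 0 := by
      simpa only [map_zero, add_zero] using hp.inner_eq_zero_of_lPeriodicallyRigid hG hw u v 0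
    have hγ' := hp.inner_eq_zero_of_lPeriodicallyRigid hG hw u v γ
    rw [← sub_sub, inner_sub_left, h₀, zero_sub, neg_eq_zero] at hγ'
    exact hne (sub_eq_zero.1 (hp.eq_zero_of_inner_eq_zero huv hγ h₀ hγ'))
  rcases isEmpty_or_nonempty V with hV | ⟨⟨v₀⟩⟩
  · exact mem_agreeOn.2 ⟨0, fun v => hV.elim v⟩
  · exact mem_agreeOn.2 ⟨w v₀, fun v _ => heq v v₀⟩

end RigidCurve

section RedundantRigidity

variable {G : LabeledGraph V E Γ}

theorem motions_deleteEdge {W : Type*} [NormedAddCommGroup W] [InnerProductSpace ℝ W]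
    (G : LabeledGraph V E Γ) (L : Γ →+ W) (p : V → W) (e : E) :
    (G.deleteEdge e).motions L p Set.univ = G.motions L p {e}ᶜ := by
  ext m
  simp only [mem_motions]
  exact ⟨fun h f hf => h ⟨f, hf⟩ trivial, fun h f _ => h f.1 f.2⟩

theorem exists_map_ne_zero {A : Type*} [AddZeroClass A] (hunb : ¬ G.Balanced Set.univ)
    {L : Γ →+ A} (hL : Function.Injective L) : ∃ γ, L γ ≠ 0 := by
  rw [Balanced] at hunb
  push Not at hunb
  obtain ⟨v, γ, -, hγ⟩ := hunb
  exact ⟨γ, (map_ne_zero_iff L hL).2 hγ⟩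

variable [Finite V]

theorem MConnected.twoConnected [Finite E] (hG : G.MConnected)
    (hiso : ∀ v, ∃ e, G.src e = v ∨ G.tgt e = v) : G.TwoConnected := by
  obtain ⟨e, -⟩ := hG.1.nonempty
  have : Nontrivial V := ⟨_, _, G.loopless e⟩
  exact twoConnected_of_nontrivial_boundary hiso fun A hA hA' => hG.nontrivial_boundary hA hA'

variable [Module.Free ℤ Γ] [Module.Finite ℤ Γ]

theorem exists_nonsingular_generic (V : Type*) [Finite V] {d : ℕ}
    (hd : Module.finrank ℤ Γ ≤ d) :
    ∃ (L : Γ →+ EuclideanSpace ℝ (Fin d)) (p : V → EuclideanSpace ℝ (Fin d)),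
      Nonsingular L ∧ Generic L p := by
  have : Countable Γ := (Module.finBasis ℤ Γ).equivFun.injective.countable
  obtain ⟨L, hL⟩ := exists_nonsingular hd
  obtain ⟨p, hp⟩ := exists_generic (V := V) L
  exact ⟨L, p, hL, hp⟩

theorem RedundantlyPeriodicallyRigidAny.some {d : ℕ} (hd : Module.finrank ℤ Γ ≤ d)
    (h : G.RedundantlyPeriodicallyRigidAny d) : G.RedundantlyPeriodicallyRigid d := by
  obtain ⟨L, p, hL, hp⟩ := exists_nonsingular_generic V hd
  exact fun e => ⟨L, p, hL, hp, h e L p hL hp⟩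

theorem mConnected_of_redundantlyPeriodicallyRigid [Finite E] (hk : Module.finrank ℤ Γ ≤ 2)
    (hiso : ∀ v, ∃ e, G.src e = v ∨ G.tgt e = v) (hunb : ¬ G.Balanced Set.univ)
    (hblock : ¬ ∃ H : G.Subgraph, H.IsBlock 0 2) (htwo : G.TwoConnected)
    (hrigid : G.RedundantlyPeriodicallyRigid 2) : G.MConnected := by
  have := htwo.1
  have hcirc (e : E) : ∃ C, G.countMatroid.IsCircuit C ∧ e ∈ C := by
    obtain ⟨L, p, hL, hp, hrigid⟩ := hrigid e
    obtain ⟨γ, hγ⟩ := exists_map_ne_zero hunb hL.injective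
    exact exists_isCircuit_of_motions_compl_singleton_le hL.injective hp
      (G.motions_deleteEdge L p e ▸ hp.motions_le_of_lPeriodicallyRigid hγ hrigid)
  obtain ⟨L, p, hL, hp⟩ := exists_nonsingular_generic V hk
  exact mConnected_of_forall_exists_isCircuit hiso hblock
    (fun A hA hA' => htwo.nontrivial_boundary hA hA') hcirc hL.injective hp

theorem MConnected.redundantlyPeriodicallyRigidAny [Finite E] (hG : G.MConnected)
    (hiso : ∀ v, ∃ e, G.src e = v ∨ G.tgt e = v) (hunb : ¬ G.Balanced Set.univ) :
    G.RedundantlyPeriodicallyRigidAny 2 := by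
  intro e L p hL hp
  apply lPeriodicallyRigid_of_motions_le
  rw [motions_deleteEdge]
  exact hG.motions_compl_singleton_le hiso hunb hL.injective hp e

end RedundantRigidity

end LabeledGraph

theorem theorem5p14 {V E Γ : Type*} [Finite V] [Finite E] [AddCommGroup Γ]
    [Module.Free ℤ Γ] [Module.Finite ℤ Γ] (hk : Module.finrank ℤ Γ ≤ 2)
    (G : LabeledGraph V E Γ)
    (hiso : ∀ v, ∃ e, G.src e = v ∨ G.tgt e = v)
    (hunb : ¬ G.Balanced Set.univ)
    (hblock : ¬ ∃ H : G.Subgraph, H.IsBlock 0 2) :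
    (G.TwoConnected ∧ G.RedundantlyPeriodicallyRigid 2 ↔ G.MConnected) ∧
    (G.TwoConnected ∧ G.RedundantlyPeriodicallyRigidAny 2 ↔ G.MConnected) := by
  have hsome : G.TwoConnected → G.RedundantlyPeriodicallyRigid 2 → G.MConnected :=
    LabeledGraph.mConnected_of_redundantlyPeriodicallyRigid hk hiso hunb hblock
  have hany : G.MConnected → G.TwoConnected ∧ G.RedundantlyPeriodicallyRigidAny 2 := fun hG =>
    ⟨hG.twoConnected hiso, hG.redundantlyPeriodicallyRigidAny hiso hunb⟩
  exact ⟨⟨fun h => hsome h.1 h.2, fun hG => ⟨(hany hG).1, (hany hG).2.some hk⟩⟩,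
    ⟨fun h => hsome h.1 (h.2.some hk), hany⟩⟩
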